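/- All notions refer to the unit sphere $S^2\subset\mathbb{R}^3$. For non-antipodal points $a,b$, the arc $ab$ is the shorter great-circle arc joining them (a single point if $a=b$) and $|ab|$ is its length. A set is convex if it contains no pair of antipodes and contains the arc joining any two of its points; a convex body is a closed convex set with non-empty interior. $H(m)$ is the closed hemisphere with center $m$; it supports a convex body $C$ if $C\subset H(m)$ and the great circle bounding $H(m)$ contains a boundary point of $C$. For hemispheres $G,H$ that are different and not opposite, $G\cap H$ is a lune; it is bounded by the semicircle $G/H\subset \mathrm{bd}(G)$ and the semicircle $H/G\subset\mathrm{bd}(H)$, and its thickness is the distance of the centers of these two semicircles. For a hemisphere $K$ supporting $C$, $K^*$ denotes a hemisphere supporting $C$ for which the lune $K\cap K^*$ has minimum thickness; this minimum is $\mathrm{width}_K(C)$. The thickness $\Delta(C)$ is the minimum of $\mathrm{width}_K(C)$ over all hemispheres $K$ supporting $C$. A convex body $R$ is reduced if $\Delta(Z)<\Delta(R)$ for every convex body $Z\subset R$, $Z\neq R$. For different hemispheres $X=H(x)$, $Y=H(y)$, $Z=H(z)$ supporting $C$, write $\prec XYZ$ if either the great circles bounding $X,Y,Z$ have no common point and $x,y,z$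 are in this order on the positively oriented boundary of the spherical triangle $xyz$, or these great circles have a common point $c\in C$ and $x,y,z$ are in this order on the positively oriented boundary of $H(c)$. **Theorem.** Let $R\subset S^2$ be a reduced convex body with $\Delta(R)<\frac{\pi}{2}$. Let $M_1$ and $M_2$ be hemispheres supporting $R$ such that $\mathrm{width}_{M_1}(R)=\Delta(R)=\mathrm{width}_{M_2}(R)$ and $\mathrm{width}_M(R)>\Delta(R)$ for every hemisphere $M$ supporting $R$ with $\prec M_1MM_2$. For $i=1,2$ let $a_i$ be the center of the semicircle $M_i/M_i^*$ and $b_i$ the center of the semicircle $M_i^*/M_i$. Then the arcs $a_1a_2$ and $b_1b_2$ are contained in the boundary of $R$, and $|a_1a_2|=|b_1b_2|$. -/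

import Mathlib

/-- Three-dimensional Euclidean space. -/
abbrev E3 : Type := EuclideanSpace ℝ (Fin 3)

/-- The unit sphere of Euclidean space, with its subspace topology. -/
abbrev S2 : Type := Metric.sphere (0 : E3) 1

noncomputable section

namespace SphGeom

/-- Spherical distance: the length of the shorter great-circle arc between two points. -/
def sphDist (p q : S2) : ℝ := InnerProductGeometry.angle (p : E3) (q : E3)

/-- The shorter great-circle arc joining two non-antipodal points
(it is the single point `a` when `a = b`). -/
def arc (a b : S2) : Set S2 :=
  {p | ∃ s t : ℝ, 0 ≤ s ∧ 0 ≤ t ∧ (p : E3) = s • (a : E3) + t • (b : E3)}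

/-- Spherical convexity: no pair of antipodes, and closed under taking arcs. -/
def IsSphConvex (C : Set S2) : Prop :=
  (∀ p ∈ C, -p ∉ C) ∧ ∀ p ∈ C, ∀ q ∈ C, arc p q ⊆ C

/-- A spherical convex body: a closed convex set with non-empty interior. -/
def IsConvexBody (C : Set S2) : Prop :=
  IsClosed C ∧ IsSphConvex C ∧ (interior C).Nonempty

/-- The closed hemisphere with center `m`. -/
def hemisphere (m : S2) : Set S2 := {p | 0 ≤ inner ℝ (m : E3) (p : E3)}

/-- The great circle bounding the hemisphere with center `m`. -/
def greatCircle (m : S2) : Set S2 := {p | inner ℝ (m : E3) (p : E3) = 0}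

/-- The hemisphere with center `m` supports `C` (at some boundary point of `C`). -/
def Supports (C : Set S2) (m : S2) : Prop :=
  C ⊆ hemisphere m ∧ ∃ p ∈ frontier C, p ∈ greatCircle m

/-- The hemispheres with centers `g`, `h` are different and not opposite,
so that their intersection is a lune. -/
def IsLunePair (g h : S2) : Prop := g ≠ h ∧ g ≠ -h

/-- The semicircle `G/H`: the one of the two semicircles bounding the lune `G ∩ H` that lies
on the boundary of `G`, where `G`, `H` are the hemispheres with centers `g`, `h`. -/
def semicircle (g h : S2) : Set S2 := greatCircle g ∩ hemisphere h

/-- The component of `h` orthogonal to `g`. -/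
def orthPart (g h : S2) : E3 := (h : E3) - inner ℝ (g : E3) (h : E3) • (g : E3)

open Classical in
/-- The center of the semicircle `G/H`: the component of `h` orthogonal to `g`, normalized
(the other branch is never met for a lune). -/
def semicircleCenter (g h : S2) : S2 :=
  if hv : orthPart g h = 0 then g
  else ⟨‖orthPart g h‖⁻¹ • orthPart g h, by
    have : ‖orthPart g h‖ ≠ 0 := norm_ne_zero_iff.mpr hv
    simp [norm_smul, this]⟩

theorem orthPart_ne_zero {g h : S2} (hl : IsLunePair g h) : orthPart g h ≠ 0 := by
  intro hv
  have hg : ‖(g : E3)‖ = 1 := by simp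
  have hh : ‖(h : E3)‖ = 1 := by simp
  have e : (h : E3) = inner ℝ (g : E3) (h : E3) • (g : E3) := sub_eq_zero.mp hv
  have hn := congrArg norm e
  rw [norm_smul, hg, hh, mul_one, Real.norm_eq_abs] at hn
  rcases eq_or_eq_neg_of_abs_eq hn.symm with h1 | h1
  · rw [h1, one_smul] at e
    exact hl.1 (Subtype.ext e.symm)
  · rw [h1, neg_one_smul] at e
    apply hl.2
    apply Subtype.ext
    simp [e]

/-- For a lune, `semicircleCenter g h` lies on the great circle bounding `G`, and `G/H` is the set
of the points of that great circle at distance at most `π / 2` from it. -/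
theorem semicircleCenter_spec {g h : S2} (hl : IsLunePair g h) :
    semicircleCenter g h ∈ greatCircle g ∧
      semicircle g h = {p | p ∈ greatCircle g ∧ sphDist p (semicircleCenter g h) ≤ Real.pi / 2} := by
  have hv := orthPart_ne_zero hl
  have hpos : 0 < ‖orthPart g h‖⁻¹ := inv_pos.mpr (norm_pos_iff.mpr hv)
  have hc : (semicircleCenter g h : E3) = ‖orthPart g h‖⁻¹ • orthPart g h := by
    simp [semicircleCenter, hv]
  have hgg : inner ℝ (g : E3) (g : E3) = 1 := by
    rw [real_inner_self_eq_norm_sq]; simp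
  refine ⟨?_, ?_⟩
  · simp only [greatCircle, Set.mem_setOf_eq]
    rw [hc, inner_smul_right, orthPart, inner_sub_right, inner_smul_right, hgg]
    ring
  · ext p
    simp only [semicircle, greatCircle, hemisphere, Set.mem_inter_iff, Set.mem_setOf_eq, sphDist]
    refine and_congr_right fun hp => ?_
    rw [InnerProductGeometry.angle, Real.arccos_le_pi_div_two, hc, inner_smul_right, orthPart,
      inner_sub_right, inner_smul_right, real_inner_comm (g : E3) (p : E3), hp, mul_zero, sub_zero,
      real_inner_comm (p : E3) (h : E3)]
    rw [← orthPart]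
    have h2 : ‖(p : E3)‖ * ‖‖orthPart g h‖⁻¹ • orthPart g h‖ = 1 := by
      rw [← hc]; simp
    rw [h2, div_one, mul_nonneg_iff_of_pos_left hpos]

/-- The thickness of the lune `G ∩ H`: the distance of the centers of `G/H` and `H/G`. -/
def luneThickness (g h : S2) : ℝ := sphDist (semicircleCenter g h) (semicircleCenter h g)

/-- `width C k`: the width of the convex body `C` determined by its supporting hemisphere `K` with
center `k`, i.e. the minimum thickness of a lune `K ∩ H` with `H` supporting `C`. -/
def width (C : Set S2) (k : S2) : ℝ :=
  sInf {t | ∃ h, Supports C h ∧ IsLunePair k h ∧ luneThickness k h = t}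

/-- `h` is the center of a hemisphere `K^*`: it supports `C`, and the lune `K ∩ K^*` has the minimum
thickness among the lunes `K ∩ H` with `H` supporting `C`. -/
def IsStar (C : Set S2) (k h : S2) : Prop :=
  Supports C h ∧ IsLunePair k h ∧
    ∀ h', Supports C h' → IsLunePair k h' → luneThickness k h ≤ luneThickness k h'

/-- The thickness of the convex body `C`: its minimum width over all supporting hemispheres. -/
def thickness (C : Set S2) : ℝ := sInf {t | ∃ k, Supports C k ∧ width C k = t}

/-- Reduced convex bodies. -/
def IsReduced (R : Set S2) : Prop :=
  IsConvexBody R ∧ ∀ Z, IsConvexBody Z → Z ⊆ R → Z ≠ R → thickness Z < thickness R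

/-- The determinant of three vectors. -/
def det3 (u v w : E3) : ℝ := Matrix.det (Matrix.of ![u.ofLp, v.ofLp, w.ofLp])

/-- The relation `≺ X Y Z` for hemispheres `X`, `Y`, `Z` with centers `x`, `y`, `z`: they are
different, all support `C`, and support it in this order (positive orientation), i.e.
* the three bounding great circles have no common point and the spherical triangle `xyz`
  is positively oriented (both are expressed by a positive determinant), or
* the three bounding great circles have a common point `c` of `C`, and `x`, `y`, `z` are in this
  order on the positively oriented boundary of the hemisphere with center `c`
  (three points on a circle are in positive order exactly when the plane triangle
  with these vertices has positive signed area). -/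
def StrictlyBetween (C : Set S2) (x y z : S2) : Prop :=
  (Supports C x ∧ Supports C y ∧ Supports C z) ∧ (x ≠ y ∧ y ≠ z ∧ z ≠ x) ∧
    (0 < det3 x y z ∨
      ∃ c ∈ C, (c ∈ greatCircle x ∧ c ∈ greatCircle y ∧ c ∈ greatCircle z) ∧
        0 < det3 c ((y : E3) - x) ((z : E3) - x))

end SphGeom

end

/-!
The proof passes to the polar side. The centers of the hemispheres containing `R` span a closed
pointed cone `D = supportCone R` (`SphGeom.supportCone`), and the lune with centers `x`, `y` has
thickness `π` minus the angle of `x` and `y` (`luneThickness_eq`). Hence, with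
`c = cos Δ(R) ∈ (0, 1)`, all vectors of `D` satisfy `⟪v, w⟫ ≥ -c ‖v‖ ‖w‖`, and a hemisphere has
width `Δ(R)` exactly when its center `m` belongs to a *diametral pair* `m`, `n`, that is, a pair of
unit vectors of `D` with `⟪m, n⟫ = -c`. The centers of the two semicircles are then the multiples
of `a = n + c m` and `b = m + c n`; the first-order condition at the minimum says that they are
nonnegative on `D`, that is, belong to `R`.

* *Diametral pairs cross* (`IsWideCone.crossing`). As a consequence the map `m ↦ n` preserves the
  cyclic order, and three pairs in positive order have their centers `a`, and also their centers
  `b`, in (weakly) positive order (`IsWideCone.ordPairs_or`).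
* *Reducedness supplies diametral pairs* (`IsReduced.exists_isDiam_inner_neg`): cutting a small cap
  off `R` at a strongly exposed point `e` decreases the thickness, and in the limit this yields
  a diametral pair with `a` a multiple of `e`.

If `R` reached beyond the great circle through `a₁` and `a₂`, or through `b₁` and `b₂`, there would
be a diametral pair with a center beyond it, and its `m` would lie strictly between `m₁` and `m₂`.
So `R` is on one side of both circles (`IsReduced.det3_centers_nonneg`), and both arcs lie in the
boundary.

For the equality of the lengths, `D` cannot have proper faces at `m` and at `n`, for a diametral
pair, which leave in opposite directions: tilting `m` and `n` along them would enlarge their angle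
(`IsWideCone.not_opposite_faces`). By the crossing property the edges `a₁a₂` and `b₁b₂` would give
such faces at `m₁`, `n₁` unless `m₁ ⊥ a₂` or `n₁ ⊥ b₂` (`IsWideCone.not_both_edges`); likewise
`m₂ ⊥ a₁` or `n₂ ⊥ b₁`. Each admissible combination gives `⟪m₁, m₂⟫ = ⟪n₁, n₂⟫`
(`IsWideCone.inner_eq_of_faces`), which is equivalent to `⟪a₁, a₂⟫ = ⟪b₁, b₂⟫`.
-/

namespace SphGeom

/-! ### Determinants and inner products in coordinates -/

theorem inner_eq_coord (u v : E3) :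
    inner ℝ u v = u 0 * v 0 + u 1 * v 1 + u 2 * v 2 := by
  simp [PiLp.inner_apply, Fin.sum_univ_three]
  ring

theorem det3_eq_coord (u v w : E3) :
    det3 u v w = u 0 * v 1 * w 2 - u 0 * v 2 * w 1 - u 1 * v 0 * w 2 + u 1 * v 2 * w 0
      + u 2 * v 0 * w 1 - u 2 * v 1 * w 0 := by
  simp [det3, Matrix.det_fin_three]

theorem det3_mul_det3 (u v w x y z : E3) :
    det3 u v w * det3 x y z =
      inner ℝ u x * (inner ℝ v y * inner ℝ w z - inner ℝ v z * inner ℝ w y)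
      - inner ℝ u y * (inner ℝ v x * inner ℝ w z - inner ℝ v z * inner ℝ w x)
      + inner ℝ u z * (inner ℝ v x * inner ℝ w y - inner ℝ v y * inner ℝ w x) := by
  simp only [det3_eq_coord, inner_eq_coord]
  ring

/-- The linear relation satisfied by four vectors of a three-dimensional space. -/
theorem det3_relation (p a x y w : E3) :
    det3 x y w * inner ℝ p a - det3 a y w * inner ℝ p x + det3 a x w * inner ℝ p y
      - det3 a x y * inner ℝ p w = 0 := by
  simp only [det3_eq_coord, inner_eq_coord]
  ring

theorem det3_rotate (u v w : E3) : det3 v w u = det3 u v w := by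
  simp only [det3_eq_coord]; ring

theorem det3_swap (u v w : E3) : det3 u w v = -det3 u v w := by
  simp only [det3_eq_coord]; ring

theorem det3_swap_left (u v w : E3) : det3 v u w = -det3 u v w := by
  simp only [det3_eq_coord]; ring

theorem det3_add_right (u v w w' : E3) : det3 u v (w + w') = det3 u v w + det3 u v w' := by
  simp only [det3_eq_coord, PiLp.add_apply]; ring

theorem det3_smul_right (u v w : E3) (t : ℝ) : det3 u v (t • w) = t * det3 u v w := by
  simp only [det3_eq_coord, PiLp.smul_apply, smul_eq_mul]; ring

/-- The cross product `u × v`, described by the functional `det3 u v` it represents. -/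
theorem exists_cross (u v : E3) : ∃ g : E3, ∀ p, inner ℝ g p = det3 u v p := by
  refine ⟨!₂[u 1 * v 2 - u 2 * v 1, u 2 * v 0 - u 0 * v 2, u 0 * v 1 - u 1 * v 0], fun p => ?_⟩
  simp [inner_eq_coord, det3_eq_coord]
  ring

/-- Lagrange's identity. -/
theorem inner_cross_self {u v g : E3} (hg : ∀ p, inner ℝ g p = det3 u v p) :
    inner ℝ g g = inner ℝ u u * inner ℝ v v - inner ℝ u v ^ 2 := by
  have h0 := hg (EuclideanSpace.single 0 1)
  have h1 := hg (EuclideanSpace.single 1 1)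
  have h2 := hg (EuclideanSpace.single 2 1)
  simp [inner_eq_coord, det3_eq_coord] at h0 h1 h2
  simp only [inner_eq_coord, h0, h1, h2]
  ring

theorem det3_sub_sub (c x y z : E3) :
    det3 c (y - x) (z - x) = det3 c y z + det3 c x y - det3 c x z := by
  simp only [det3_eq_coord, PiLp.sub_apply]
  ring

theorem det3_shear (c : ℝ) (m n p : E3) :
    det3 (n + c • m) m p = -det3 m n p := by
  simp only [det3_eq_coord, PiLp.add_apply, PiLp.smul_apply, smul_eq_mul]; ring

theorem eq_of_inner_eq_one {x y : E3} (hx : ‖x‖ = 1) (hy : ‖y‖ = 1) (h : inner ℝ x y = 1) :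
    x = y :=
  (inner_eq_one_iff_of_norm_eq_one hx hy).1 h

theorem inner_self_of_norm_one {x : E3} (hx : ‖x‖ = 1) : inner ℝ x x = 1 := by
  rw [real_inner_self_eq_norm_sq, hx]; norm_num

/-! ### Diametral pairs of a cone -/

/-- `D` is a convex cone which is pointed (as witnessed by `p₀`) and on which the angle of any two
vectors has cosine at least `-c`. In the application `D` is the cone spanned by the centers of the
hemispheres containing a convex body and `c` is the cosine of its thickness. -/
structure IsWideCone (D : Set E3) (c : ℝ) : Prop where
  c_pos : 0 < c
  c_lt_one : c < 1
  add_mem : ∀ v ∈ D, ∀ w ∈ D, v + w ∈ D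
  smul_mem : ∀ t : ℝ, 0 ≤ t → ∀ v ∈ D, t • v ∈ D
  pointed : ∃ p₀ : E3, ∀ v ∈ D, v ≠ 0 → 0 < inner ℝ p₀ v
  le_inner : ∀ v ∈ D, ∀ w ∈ D, -c * (‖v‖ * ‖w‖) ≤ inner ℝ v w

/-- A pair of unit vectors of `D` enclosing the largest angle allowed by `IsWideCone D c`. -/
structure IsDiam (D : Set E3) (c : ℝ) (m n : E3) : Prop where
  left_mem : m ∈ D
  right_mem : n ∈ D
  norm_left : ‖m‖ = 1
  norm_right : ‖n‖ = 1
  inner_eq : inner ℝ m n = -c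

theorem IsDiam.symm {D : Set E3} {c : ℝ} {m n : E3} (h : IsDiam D c m n) : IsDiam D c n m :=
  ⟨h.right_mem, h.left_mem, h.norm_right, h.norm_left, by rw [real_inner_comm, h.inner_eq]⟩

/-- First-order condition at a minimum of `inner ℝ x` over the unit vectors of a cone. -/
theorem inner_sub_nonneg_of_isMin {D : Set E3} (hadd : ∀ v ∈ D, ∀ w ∈ D, v + w ∈ D)
    (hsmul : ∀ t : ℝ, 0 ≤ t → ∀ v ∈ D, t • v ∈ D) {x y : E3} {μ : ℝ} (hy : y ∈ D)
    (hy1 : ‖y‖ = 1) (hxy : inner ℝ x y = μ) (hmin : ∀ d ∈ D, μ * ‖d‖ ≤ inner ℝ x d)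
    {d : E3} (hd : d ∈ D) : 0 ≤ inner ℝ (x - μ • y) d := by
  have hyy := inner_self_of_norm_one hy1
  have key : ∀ t : ℝ, 0 < t → μ * ‖y + t • d‖ ≤ μ + t * inner ℝ x d := by
    intro t ht
    have h := hmin _ (hadd _ hy _ (hsmul t ht.le _ hd))
    rwa [inner_add_right, inner_smul_right, hxy] at h
  have hn : ∀ t : ℝ, ‖y + t • d‖ ^ 2 = 1 + 2 * t * inner ℝ y d + t ^ 2 * ‖d‖ ^ 2 := by
    intro t
    rw [← real_inner_self_eq_norm_sq, ← real_inner_self_eq_norm_sq, inner_add_left,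
      inner_add_right, inner_add_right, inner_smul_left, inner_smul_right, inner_smul_left,
      inner_smul_right, hyy, real_inner_comm y d]
    simp
    ring
  rw [inner_sub_left, inner_smul_left]
  simp only [conj_trivial]
  rcases le_or_gt 0 μ with h0 | h0
  · have h1 := key 1 one_pos
    have h2 : inner ℝ y (y + (1 : ℝ) • d) ≤ ‖y‖ * ‖y + (1 : ℝ) • d‖ := real_inner_le_norm _ _
    rw [inner_add_right, inner_smul_right, hyy, hy1] at h2
    nlinarith
  · by_contra hneg
    push Not at hneg
    set e := -(inner ℝ x d - μ * inner ℝ y d) with he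
    have hepos : 0 < e := by linarith
    have hb : 0 < -μ * ‖d‖ ^ 2 + 1 := by nlinarith [sq_nonneg ‖d‖]
    -- a step `t` so small that the quadratic term is dominated by the linear one
    set t := e / (-μ * ‖d‖ ^ 2 + 1) with ht
    have htpos : 0 < t := by positivity
    have hte : t * (-μ * ‖d‖ ^ 2 + 1) = e := div_mul_cancel₀ e hb.ne'
    have h1 := key t htpos
    have h2 : ‖y + t • d‖ ≤ (1 + ‖y + t • d‖ ^ 2) / 2 := by nlinarith [sq_nonneg (‖y + t • d‖ - 1)]
    rw [hn] at h2
    have h3 : μ * ((1 + (1 + 2 * t * inner ℝ y d + t ^ 2 * ‖d‖ ^ 2)) / 2) ≤ μ * ‖y + t • d‖ :=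
      mul_le_mul_of_nonpos_left h2 h0.le
    have h4 : t * e ≤ t * (t * (-μ * ‖d‖ ^ 2) / 2) := by
      have : t * e = -(t * inner ℝ x d) + μ * t * inner ℝ y d := by rw [he]; ring
      rw [this]; nlinarith
    have h5 : e ≤ t * (-μ * ‖d‖ ^ 2) / 2 := le_of_mul_le_mul_left h4 htpos
    have h6 : 0 ≤ t * (-μ * ‖d‖ ^ 2) := by
      have : 0 ≤ -μ * ‖d‖ ^ 2 := by nlinarith [sq_nonneg ‖d‖]
      positivity
    nlinarith

section Pairs

variable {D : Set E3} {c : ℝ}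

theorem IsWideCone.inner_left_nonneg (hD : IsWideCone D c) {m n d : E3} (h : IsDiam D c m n)
    (hd : d ∈ D) : 0 ≤ inner ℝ n d + c * inner ℝ m d := by
  have := inner_sub_nonneg_of_isMin hD.add_mem hD.smul_mem (x := n) (μ := -c) h.left_mem
    h.norm_left (by rw [real_inner_comm, h.inner_eq])
    (fun d hd => by simpa [h.norm_right] using hD.le_inner n h.right_mem d hd) hd
  rw [inner_sub_left, inner_smul_left] at this
  simpa using this

theorem IsWideCone.inner_right_nonneg (hD : IsWideCone D c) {m n d : E3} (h : IsDiam D c m n)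
    (hd : d ∈ D) : 0 ≤ inner ℝ m d + c * inner ℝ n d :=
  hD.inner_left_nonneg h.symm hd

theorem IsWideCone.partner_unique (hD : IsWideCone D c) {m n n' : E3} (h : IsDiam D c m n)
    (h' : IsDiam D c m n') : n = n' := by
  have h1 := hD.le_inner m h.left_mem (n + n') (hD.add_mem _ h.right_mem _ h'.right_mem)
  rw [inner_add_right, h.inner_eq, h'.inner_eq, h.norm_left] at h1
  have h2 : 2 ≤ ‖n + n'‖ := by nlinarith [hD.c_pos]
  have h3 : ‖n + n'‖ ^ 2 = 2 + 2 * inner ℝ n n' := by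
    rw [norm_add_sq_real, h.norm_right, h'.norm_right]; ring
  have h4 : inner ℝ n n' ≤ 1 := by
    simpa [h.norm_right, h'.norm_right] using real_inner_le_norm n n'
  exact eq_of_inner_eq_one h.norm_right h'.norm_right (by nlinarith)

theorem IsWideCone.le_inner_unit (hD : IsWideCone D c) {v w : E3} (hv : v ∈ D) (hw : w ∈ D)
    (hv1 : ‖v‖ = 1) (hw1 : ‖w‖ = 1) : -c ≤ inner ℝ v w := by
  simpa [hv1, hw1] using hD.le_inner v hv w hw

/-- The expansion of an inner product in the basis `m`, `n`, `m × n` and its dual basis. -/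
theorem IsDiam.inner_expand {m n : E3} (h : IsDiam D c m n) (p w : E3) :
    (1 - c ^ 2) * inner ℝ p w = (inner ℝ m w + c * inner ℝ n w) * inner ℝ m p
      + (inner ℝ n w + c * inner ℝ m w) * inner ℝ n p + det3 m n p * det3 m n w := by
  rw [det3_mul_det3, inner_self_of_norm_one h.norm_left, inner_self_of_norm_one h.norm_right,
    h.inner_eq, real_inner_comm m n, h.inner_eq, real_inner_comm m p, real_inner_comm n p]
  ring

/-- Two different diametral pairs cross: the great circle through the points of the first one
strictly separates the points of the second one. -/
theorem IsWideCone.crossing (hD : IsWideCone D c) {m₁ n₁ m₂ n₂ : E3} (h₁ : IsDiam D c m₁ n₁)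
    (h₂ : IsDiam D c m₂ n₂) (hm : m₂ ≠ m₁) (hn : m₂ ≠ n₁) :
    det3 m₁ n₁ m₂ * det3 m₁ n₁ n₂ < 0 := by
  have c0 := hD.c_pos
  have c1 := hD.c_lt_one
  have e1 := hD.inner_left_nonneg h₁ h₂.left_mem
  have e2 := hD.inner_left_nonneg h₁ h₂.right_mem
  have e3 := hD.inner_right_nonneg h₁ h₂.left_mem
  have e4 := hD.inner_right_nonneg h₁ h₂.right_mem
  have e5 := hD.inner_left_nonneg h₂ h₁.left_mem
  have e6 := hD.inner_left_nonneg h₂ h₁.right_mem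
  have e7 := hD.inner_right_nonneg h₂ h₁.left_mem
  have e8 := hD.inner_right_nonneg h₂ h₁.right_mem
  have r1 : inner ℝ m₁ n₂ ≠ 1 := by
    intro h
    have := eq_of_inner_eq_one h₁.norm_left h₂.norm_right h
    subst this
    exact hn (hD.partner_unique h₂.symm h₁)
  have r1' : inner ℝ m₁ n₂ < 1 := lt_of_le_of_ne
    (by simpa [h₁.norm_left, h₂.norm_right] using real_inner_le_norm m₁ n₂) r1
  have rc : -c < inner ℝ m₁ n₂ := by
    refine lt_of_le_of_ne (hD.le_inner_unit h₁.left_mem h₂.right_mem h₁.norm_left h₂.norm_right)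
      fun h => hm ?_
    have h3 : IsDiam D c m₁ n₂ :=
      ⟨h₁.left_mem, h₂.right_mem, h₁.norm_left, h₂.norm_right, h.symm⟩
    exact hD.partner_unique h₂.symm h3.symm
  have rc' : -c < inner ℝ n₁ m₂ := by
    refine lt_of_le_of_ne (hD.le_inner_unit h₁.right_mem h₂.left_mem h₁.norm_right h₂.norm_left)
      fun h => hm ?_
    have h3 : IsDiam D c n₁ m₂ :=
      ⟨h₁.right_mem, h₂.left_mem, h₁.norm_right, h₂.norm_left, h.symm⟩
    exact hD.partner_unique h3 h₁.symm
  have hdet : det3 m₁ n₁ m₂ * det3 m₁ n₁ n₂ = -c * (1 - c ^ 2)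
      - inner ℝ n₁ n₂ * (inner ℝ n₁ m₂ + c * inner ℝ m₁ m₂)
      - inner ℝ m₁ n₂ * (inner ℝ m₁ m₂ + c * inner ℝ n₁ m₂) := by
    rw [det3_mul_det3, inner_self_of_norm_one h₁.norm_left, inner_self_of_norm_one h₁.norm_right,
      h₁.inner_eq, real_inner_comm m₁ n₁, h₁.inner_eq, h₂.inner_eq, real_inner_comm m₁ m₂,
      real_inner_comm n₁ m₂]
    ring
  -- nonnegativity of the products of the centers of each pair with the other pair, and the bounds
  -- `-c < ⟪m₁, n₂⟫ < 1` and `-c < ⟪n₁, m₂⟫`, make this negative whatever the signs of `⟪m₁, n₂⟫`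
  -- and `⟪n₁, n₂⟫` are
  rw [hdet]
  rw [real_inner_comm m₁ n₂, real_inner_comm m₁ m₂] at e5
  rw [real_inner_comm n₁ n₂, real_inner_comm n₁ m₂] at e6
  rw [real_inner_comm m₁ n₂, real_inner_comm m₁ m₂] at e7
  rw [real_inner_comm n₁ n₂, real_inner_comm n₁ m₂] at e8
  generalize inner ℝ m₁ m₂ = p at *
  generalize inner ℝ n₁ n₂ = q at *
  generalize inner ℝ m₁ n₂ = r at *
  generalize inner ℝ n₁ m₂ = s at *
  have hk : 0 < 1 - c ^ 2 := by nlinarith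
  rcases le_or_gt 0 r with hr | hr
  · rcases le_or_gt 0 q with hq | hq
    · nlinarith [mul_nonneg hr e3, mul_nonneg hq e1, mul_pos c0 hk]
    · have h1 : 0 ≤ (q + c * r) * (s + c * p) := mul_nonneg e2 e1
      have h2 : 0 < c + p * r := by
        have : 0 ≤ r * (p + c * r) := mul_nonneg hr e7
        nlinarith [mul_pos c0 (show 0 < 1 - r ^ 2 by nlinarith)]
      nlinarith [mul_pos hk h2]
  · have h1 : 0 ≤ (r + c * q) * (s + c * p) := mul_nonneg e4 e1
    have h2 : 0 < c ^ 2 - r * s := by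
      rcases le_or_gt 0 s with hs | hs <;> nlinarith
    nlinarith [mul_pos hk h2]

end Pairs

/-! ### Cyclic order of diametral pairs -/

/-- `x`, `y`, `z` are in positive order on the boundary of the cone `D`: either they are positively
oriented, or they lie on the face `v^⊥` of `D` cut out by a vector `v` of the dual cone, and are in
positive order around `v`. -/
def PosOrd (D : Set E3) (x y z : E3) : Prop :=
  0 < det3 x y z ∨ ∃ v : E3, (∀ d ∈ D, 0 ≤ inner ℝ v d) ∧
    inner ℝ v x = 0 ∧ inner ℝ v y = 0 ∧ inner ℝ v z = 0 ∧ 0 < det3 v (y - x) (z - x)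

theorem PosOrd.rotate {D : Set E3} {x y z : E3} (h : PosOrd D x y z) : PosOrd D y z x := by
  rcases h with h | ⟨v, hv, hx, hy, hz, h⟩
  · left; rwa [det3_rotate]
  · refine Or.inr ⟨v, hv, hy, hz, hx, ?_⟩
    rw [det3_sub_sub] at h ⊢
    have h1 := det3_swap v x z
    have h2 := det3_swap v x y
    linarith

variable {D : Set E3} {c : ℝ}

theorem IsDiam.ne_zero {m n : E3} (h : IsDiam D c m n) : m ≠ 0 := by
  rintro rfl
  simpa using h.norm_left

theorem IsDiam.inner_center_self {m n : E3} (h : IsDiam D c m n) :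
    inner ℝ (n + c • m) m = 0 := by
  rw [inner_add_left, inner_smul_left, inner_self_of_norm_one h.norm_left, real_inner_comm,
    h.inner_eq]
  simp

theorem IsDiam.inner_center_partner {m n : E3} (h : IsDiam D c m n) :
    inner ℝ (n + c • m) n = 1 - c ^ 2 := by
  rw [inner_add_left, inner_smul_left, inner_self_of_norm_one h.norm_right, h.inner_eq]
  simp; ring

theorem IsWideCone.inner_center_nonneg (hD : IsWideCone D c) {m n d : E3} (h : IsDiam D c m n)
    (hd : d ∈ D) : 0 ≤ inner ℝ (n + c • m) d := by
  rw [inner_add_left, inner_smul_left]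
  exact hD.inner_left_nonneg h hd

theorem IsWideCone.one_sub_sq_pos (hD : IsWideCone D c) : 0 < 1 - c ^ 2 := by
  nlinarith [hD.c_pos, hD.c_lt_one]

/-- The matrix of the products of the `mᵢ` with the centers `nⱼ + c mⱼ` is nonnegative with zero
diagonal, hence has nonnegative determinant. -/
theorem IsWideCone.det3_mul_det3_center_nonneg (hD : IsWideCone D c) {m₁ n₁ m₂ n₂ m₃ n₃ : E3}
    (h₁ : IsDiam D c m₁ n₁) (h₂ : IsDiam D c m₂ n₂) (h₃ : IsDiam D c m₃ n₃) :
    0 ≤ det3 m₁ m₂ m₃ * det3 (n₁ + c • m₁) (n₂ + c • m₂) (n₃ + c • m₃) := by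
  have e12 := hD.inner_center_nonneg h₁ h₂.left_mem
  have e13 := hD.inner_center_nonneg h₁ h₃.left_mem
  have e21 := hD.inner_center_nonneg h₂ h₁.left_mem
  have e23 := hD.inner_center_nonneg h₂ h₃.left_mem
  have e31 := hD.inner_center_nonneg h₃ h₁.left_mem
  have e32 := hD.inner_center_nonneg h₃ h₂.left_mem
  rw [mul_comm, det3_mul_det3, h₁.inner_center_self, h₂.inner_center_self, h₃.inner_center_self]
  have := mul_nonneg e12 (mul_nonneg e23 e31)
  have := mul_nonneg e13 (mul_nonneg e21 e32)
  nlinarith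

/-- If `m₂` is to the left of the oriented great circle `m₁n₁`, then `m₁` is to the right of
`m₂n₂`. -/
theorem IsWideCone.side_antisymm (hD : IsWideCone D c) {m₁ n₁ m₂ n₂ : E3} (h₁ : IsDiam D c m₁ n₁)
    (h₂ : IsDiam D c m₂ n₂) (hm : m₂ ≠ m₁) (hn : m₂ ≠ n₁) (h : 0 < det3 m₁ n₁ m₂) :
    det3 m₂ n₂ m₁ < 0 := by
  obtain ⟨p, hp⟩ := hD.pointed
  have p1 := hp m₁ h₁.left_mem h₁.ne_zero
  have p2 := hp n₁ h₁.right_mem h₁.symm.ne_zero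
  have p3 := hp m₂ h₂.left_mem h₂.ne_zero
  have p4 := hp n₂ h₂.right_mem h₂.symm.ne_zero
  have hn' : m₁ ≠ n₂ := by
    rintro rfl
    exact hn (hD.partner_unique h₂.symm h₁)
  have c12 := hD.crossing h₁ h₂ hm hn
  have c21 := hD.crossing h₂ h₁ hm.symm hn'
  have hneg : det3 m₁ n₁ n₂ < 0 := by nlinarith
  by_contra hcon
  push Not at hcon
  have hpos : 0 < det3 m₂ n₂ m₁ := lt_of_le_of_ne hcon fun h0 => by
    rw [← h0, zero_mul] at c21; exact lt_irrefl _ c21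
  have hneg' : det3 m₂ n₂ n₁ < 0 := by nlinarith
  have rel := det3_relation p m₁ n₁ m₂ n₂
  rw [det3_rotate m₂ n₂ n₁ |>.symm, det3_rotate n₂ n₁ m₂ |>.symm] at hneg'
  rw [det3_rotate m₂ n₂ m₁ |>.symm, det3_rotate n₂ m₁ m₂ |>.symm] at hpos
  nlinarith [mul_pos_of_neg_of_neg (neg_lt_zero.2 p1) hneg', mul_pos hpos p2,
    mul_pos_of_neg_of_neg (neg_lt_zero.2 p3) hneg, mul_pos h p4]

/-- If `y` is to the right and `w` to the left of the great circle through the diametral pair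
`m`, `n`, then `m`, `y`, `w` are in positive order, and so are the centers belonging to them. -/
theorem IsWideCone.posOrd_of_sides (hD : IsWideCone D c) {m n y y' w w' : E3}
    (h : IsDiam D c m n) (hy : IsDiam D c y y') (hw : IsDiam D c w w')
    (h1 : det3 m n y < 0) (h2 : 0 < det3 m n w) :
    PosOrd D m y w ∧ 0 ≤ det3 (n + c • m) (y' + c • y) (w' + c • w) := by
  set a := n + c • m with ha
  have k := hD.one_sub_sq_pos
  have ay : 0 ≤ inner ℝ a y := hD.inner_center_nonneg h hy.left_mem
  have aw : 0 ≤ inner ℝ a w := hD.inner_center_nonneg h hw.left_mem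
  have am : inner ℝ a m = 0 := h.inner_center_self
  have an : inner ℝ a n = 1 - c ^ 2 := h.inner_center_partner
  have sy : 0 < det3 a m y := by rw [ha, det3_shear]; linarith
  have sw : det3 a m w < 0 := by rw [ha, det3_shear]; linarith
  -- pairing the linear relation of `m, n, y, w` with `a` computes `det3 m y w`
  have rel := det3_relation a n m y w
  rw [am, an, det3_swap_left m n w, det3_swap_left m n y] at rel
  have prod := hD.det3_mul_det3_center_nonneg h hy hw
  have hd : 0 ≤ det3 m y w := by
    by_contra hneg
    push Not at hneg
    nlinarith [mul_nonneg ay h2.le, mul_nonneg aw (neg_nonneg.2 h1.le), mul_pos k (neg_pos.2 hneg)]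
  rcases hd.lt_or_eq with hd | hd
  · exact ⟨Or.inl hd, nonneg_of_mul_nonneg_right prod hd⟩
  rw [← hd] at rel
  have ay0 : inner ℝ a y = 0 := by
    nlinarith [mul_nonneg ay h2.le, mul_nonneg aw (neg_nonneg.2 h1.le)]
  have aw0 : inner ℝ a w = 0 := by
    nlinarith [mul_nonneg ay h2.le, mul_nonneg aw (neg_nonneg.2 h1.le)]
  -- `m`, `y`, `w` lie in the plane `a^⊥`
  have plane : ∀ p : E3, det3 a y w * inner ℝ p m =
      det3 a m w * inner ℝ p y - det3 a m y * inner ℝ p w := by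
    intro p
    have := det3_relation p a m y w
    rw [← hd] at this
    linarith
  obtain ⟨p, hp⟩ := hD.pointed
  have p1 := hp m h.left_mem h.ne_zero
  have p2 := hp y hy.left_mem hy.ne_zero
  have p3 := hp w hw.left_mem hw.ne_zero
  have syw : det3 a y w < 0 := by
    by_contra hcon
    push Not at hcon
    nlinarith [plane p, mul_nonneg hcon p1.le, mul_pos sy p3, mul_pos (neg_pos.2 sw) p2]
  refine ⟨Or.inr ⟨a, fun d hd => hD.inner_center_nonneg h hd, am, ay0, aw0, ?_⟩, ?_⟩
  · rw [det3_sub_sub]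
    have hm := plane m
    rw [inner_self_of_norm_one h.norm_left] at hm
    have l1 : inner ℝ m y < 1 := by
      refine lt_of_le_of_ne (by simpa [h.norm_left, hy.norm_left] using real_inner_le_norm m y) ?_
      intro h0
      rw [← eq_of_inner_eq_one h.norm_left hy.norm_left h0] at h1
      simp [det3_eq_coord] at h1
      nlinarith
    have l2 : inner ℝ m w ≤ 1 := by
      simpa [h.norm_left, hw.norm_left] using real_inner_le_norm m w
    nlinarith [mul_pos (neg_pos.2 sw) (sub_pos.2 l1), mul_nonneg sy.le (sub_nonneg.2 l2)]
  · have e := det3_mul_det3 a y w a (y' + c • y) (w' + c • w)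
    rw [real_inner_comm a y, ay0, real_inner_comm a w, aw0, real_inner_comm (y' + c • y) y,
      hy.inner_center_self, real_inner_comm (w' + c • w) w, hw.inner_center_self,
      real_inner_comm (w' + c • w) y, real_inner_comm (y' + c • y) w] at e
    have e1 := hD.inner_center_nonneg hy hw.left_mem
    have e2 := hD.inner_center_nonneg hw hy.left_mem
    have e3 : 0 ≤ inner ℝ a a := real_inner_self_nonneg
    by_contra hcon
    push Not at hcon
    nlinarith [mul_pos_of_neg_of_neg syw hcon, mul_nonneg e3 (mul_nonneg e1 e2)]

/-- Three diametral pairs are in positive order, together with both kinds of centers. -/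
def OrdPairs (D : Set E3) (c : ℝ) (m₁ n₁ m₂ n₂ m₃ n₃ : E3) : Prop :=
  PosOrd D m₁ m₂ m₃ ∧ 0 ≤ det3 (n₁ + c • m₁) (n₂ + c • m₂) (n₃ + c • m₃) ∧
    0 ≤ det3 (m₁ + c • n₁) (m₂ + c • n₂) (m₃ + c • n₃)

theorem OrdPairs.rotate {m₁ n₁ m₂ n₂ m₃ n₃ : E3} (h : OrdPairs D c m₁ n₁ m₂ n₂ m₃ n₃) :
    OrdPairs D c m₂ n₂ m₃ n₃ m₁ n₁ :=
  ⟨h.1.rotate, by rw [det3_rotate]; exact h.2.1, by rw [det3_rotate]; exact h.2.2⟩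

theorem IsWideCone.ordPairs_of_sides (hD : IsWideCone D c) {m n y y' w w' : E3}
    (h : IsDiam D c m n) (hy : IsDiam D c y y') (hw : IsDiam D c w w')
    (ym : y ≠ m) (yn : y ≠ n) (wm : w ≠ m) (wn : w ≠ n)
    (h1 : det3 m n y < 0) (h2 : 0 < det3 m n w) : OrdPairs D c m n y y' w w' := by
  have cy := hD.crossing h hy ym yn
  have cw := hD.crossing h hw wm wn
  have hy' : 0 < det3 m n y' := by nlinarith
  have hw' : det3 m n w' < 0 := by nlinarith
  have o1 := hD.posOrd_of_sides h hy hw h1 h2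
  have o2 := hD.posOrd_of_sides h.symm hy.symm hw.symm
    (by rw [det3_swap_left]; linarith) (by rw [det3_swap_left]; linarith)
  exact ⟨o1.1, o1.2, o2.2⟩

theorem IsWideCone.ordPairs_of_swapped (hD : IsWideCone D c) {m n m₃ n₃ : E3}
    (h : IsDiam D c m n) (h₃ : IsDiam D c m₃ n₃) (h3m : m₃ ≠ m) (h3n : m₃ ≠ n) :
    OrdPairs D c m n n m m₃ n₃ ∨ OrdPairs D c m n m₃ n₃ n m := by
  have cr := hD.crossing h h₃ h3m h3n
  rcases lt_or_ge 0 (det3 m n m₃) with hpos | hneg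
  · have p1 := hD.det3_mul_det3_center_nonneg h h.symm h₃
    have p2 := hD.det3_mul_det3_center_nonneg h.symm h h₃.symm
    have hn : 0 < det3 n m n₃ := by rw [det3_swap_left]; nlinarith
    exact Or.inl ⟨Or.inl hpos, nonneg_of_mul_nonneg_right p1 hpos,
      nonneg_of_mul_nonneg_right p2 hn⟩
  · have hne : det3 m n m₃ ≠ 0 := fun h0 => by rw [h0, zero_mul] at cr; exact lt_irrefl _ cr
    have hlt := lt_of_le_of_ne hneg hne
    have hpos : 0 < det3 m m₃ n := by rw [det3_swap]; exact neg_pos.2 hlt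
    have p1 := hD.det3_mul_det3_center_nonneg h h₃ h.symm
    have p2 := hD.det3_mul_det3_center_nonneg h.symm h₃.symm h
    have hn : 0 < det3 n n₃ m := by rw [det3_swap, det3_swap_left]; nlinarith
    exact Or.inr ⟨Or.inl hpos, nonneg_of_mul_nonneg_right p1 hpos,
      nonneg_of_mul_nonneg_right p2 hn⟩

/-- Three diametral pairs have the same cyclic order on both sides: passing to the partners
preserves the order. -/
theorem IsWideCone.ordPairs_or (hD : IsWideCone D c) {m₁ n₁ m₂ n₂ m₃ n₃ : E3}
    (h₁ : IsDiam D c m₁ n₁) (h₂ : IsDiam D c m₂ n₂) (h₃ : IsDiam D c m₃ n₃)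
    (h12 : m₁ ≠ m₂) (h13 : m₁ ≠ m₃) (h23 : m₂ ≠ m₃) :
    OrdPairs D c m₁ n₁ m₂ n₂ m₃ n₃ ∨ OrdPairs D c m₁ n₁ m₃ n₃ m₂ n₂ := by
  by_cases s12 : m₂ = n₁
  · subst s12
    obtain rfl := hD.partner_unique h₁.symm h₂
    exact hD.ordPairs_of_swapped h₁ h₃ h13.symm h23.symm
  by_cases s13 : m₃ = n₁
  · subst s13
    obtain rfl := hD.partner_unique h₁.symm h₃
    exact (hD.ordPairs_of_swapped h₁ h₂ h12.symm s12).symm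
  by_cases s23 : m₃ = n₂
  · subst s23
    obtain rfl := hD.partner_unique h₂.symm h₃
    exact (hD.ordPairs_of_swapped h₂ h₁ h12 h13).imp (fun h => h.rotate.rotate) fun h => h.rotate
  have t12 : m₁ ≠ n₂ := by rintro rfl; exact s12 (hD.partner_unique h₂.symm h₁)
  have t13 : m₁ ≠ n₃ := by rintro rfl; exact s13 (hD.partner_unique h₃.symm h₁)
  have t23 : m₂ ≠ n₃ := by rintro rfl; exact s23 (hD.partner_unique h₃.symm h₂)
  have side : ∀ {m n m' n' : E3}, IsDiam D c m n → IsDiam D c m' n' → m' ≠ m → m' ≠ n → m ≠ n' →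
      (0 < det3 m n m' ∧ det3 m' n' m < 0) ∨ (det3 m n m' < 0 ∧ 0 < det3 m' n' m) := by
    intro m n m' n' h h' e1 e2 e3
    have c1 := hD.crossing h h' e1 e2
    have c2 := hD.crossing h' h e1.symm e3
    rcases lt_trichotomy (det3 m n m') 0 with hlt | heq | hgt
    · refine Or.inr ⟨hlt, ?_⟩
      rcases lt_trichotomy (det3 m' n' m) 0 with hlt' | heq' | hgt'
      · -- both on the right: the swapped second pair gives a contradiction
        have h3 : 0 < det3 n m m' := by rw [det3_swap_left]; linarith
        have h4 := hD.side_antisymm h.symm h' e2 e1 h3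
        nlinarith
      · rw [heq', zero_mul] at c2; exact absurd c2 (lt_irrefl _)
      · exact hgt'
    · rw [heq, zero_mul] at c1; exact absurd c1 (lt_irrefl _)
    · exact Or.inl ⟨hgt, hD.side_antisymm h h' e1 e2 hgt⟩
  -- some pair has one of the two others on each side; take it as the base
  rcases side h₁ h₂ h12.symm s12 t12 with a12 | a12 <;>
  rcases side h₁ h₃ h13.symm s13 t13 with a13 | a13 <;>
  rcases side h₂ h₃ h23.symm s23 t23 with a23 | a23
  · exact Or.inr (hD.ordPairs_of_sides h₂ h₁ h₃ h12 t12 h23.symm s23 a12.2 a23.1).rotate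
  · exact Or.inl (hD.ordPairs_of_sides h₃ h₁ h₂ h13 t13 h23 t23 a13.2 a23.2).rotate
  · exact Or.inr (hD.ordPairs_of_sides h₁ h₃ h₂ h13.symm s13 h12.symm s12 a13.1 a12.1)
  · exact Or.inr (hD.ordPairs_of_sides h₁ h₃ h₂ h13.symm s13 h12.symm s12 a13.1 a12.1)
  · exact Or.inl (hD.ordPairs_of_sides h₁ h₂ h₃ h12.symm s12 h13.symm s13 a12.1 a13.1)
  · exact Or.inl (hD.ordPairs_of_sides h₁ h₂ h₃ h12.symm s12 h13.symm s13 a12.1 a13.1)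
  · exact Or.inr (hD.ordPairs_of_sides h₃ h₂ h₁ h23 t23 h13 t13 a23.2 a13.2).rotate.rotate
  · exact Or.inl (hD.ordPairs_of_sides h₂ h₃ h₁ h23.symm s23 h12 t12 a23.1 a12.2).rotate.rotate

/-! ### Edges joining consecutive centers -/

/-- Tilting both members of a diametral pair along faces of `D` in opposite directions would
increase their angle. -/
theorem IsWideCone.not_opposite_faces (hD : IsWideCone D c) {m n g f : E3} (h : IsDiam D c m n)
    (hg : g ∈ D) (hf : f ∈ D) (ga : inner ℝ (n + c • m) g = 0) (fb : inner ℝ (m + c • n) f = 0) :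
    0 ≤ det3 m n g * det3 m n f := by
  by_contra hneg
  push Not at hneg
  have c0 := hD.c_pos
  have c1 := hD.c_lt_one
  have k := hD.one_sub_sq_pos
  have e1 := hD.inner_right_nonneg h hg
  have e2 := hD.inner_left_nonneg h hf
  have igg := h.inner_expand g g
  have iff := h.inner_expand f f
  have igf := h.inner_expand g f
  have mm := inner_self_of_norm_one h.norm_left
  have nn := inner_self_of_norm_one h.norm_right
  have mn := h.inner_eq
  rw [inner_add_left, inner_smul_left] at ga fb
  simp only [conj_trivial] at ga fb
  have hng : inner ℝ n g = -c * inner ℝ m g := by linarith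
  have hmf : inner ℝ m f = -c * inner ℝ n f := by linarith
  rw [hng] at igg igf e1
  rw [hmf] at iff igf e2
  have hG : 0 ≤ inner ℝ m g := by
    by_contra hc; push Not at hc; nlinarith [mul_pos k (neg_pos.2 hc)]
  have hF : 0 ≤ inner ℝ n f := by
    by_contra hc; push Not at hc; nlinarith [mul_pos k (neg_pos.2 hc)]
  generalize hNg : det3 m n g = Ng at *
  generalize hNf : det3 m n f = Nf at *
  have hab : |Ng| * |Nf| = -(Ng * Nf) := by rw [← abs_mul, abs_of_neg hneg]
  -- for a unit normal `ν` of the plane of `m`, `n`, the vectors `v` and `w` below are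
  -- `A m + B ν` and `A n - B ν` with the same `A` and `B`, so `⟪v, w⟫ = -c A² - B²`
  have mem_v : (1 + |Ng| * inner ℝ n f) • m + |Nf| • g ∈ D :=
    hD.add_mem _ (hD.smul_mem _ (by positivity) _ h.left_mem) _ (hD.smul_mem _ (abs_nonneg _) _ hg)
  have mem_w : (1 + |Nf| * inner ℝ m g) • n + |Ng| • f ∈ D :=
    hD.add_mem _ (hD.smul_mem _ (by positivity) _ h.right_mem) _
      (hD.smul_mem _ (abs_nonneg _) _ hf)
  have hle := hD.le_inner _ mem_v _ mem_w
  set v := (1 + |Ng| * inner ℝ n f) • m + |Nf| • g with hv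
  set w := (1 + |Nf| * inner ℝ m g) • n + |Ng| • f with hw
  have sNg : |Ng| ^ 2 = Ng ^ 2 := sq_abs _
  have sNf : |Nf| ^ 2 = Nf ^ 2 := sq_abs _
  have v2 : (1 - c ^ 2) * inner ℝ v v = (1 - c ^ 2) *
      (1 + |Nf| * inner ℝ m g + |Ng| * inner ℝ n f) ^ 2 + (Ng * Nf) ^ 2 := by
    rw [hv]
    simp only [inner_add_left, inner_add_right, inner_smul_left, inner_smul_right, conj_trivial,
      mm, real_inner_comm m g]
    linear_combination |Nf| ^ 2 * igg + Ng ^ 2 * sNf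
  have w2 : (1 - c ^ 2) * inner ℝ w w = (1 - c ^ 2) *
      (1 + |Nf| * inner ℝ m g + |Ng| * inner ℝ n f) ^ 2 + (Ng * Nf) ^ 2 := by
    rw [hw]
    simp only [inner_add_left, inner_add_right, inner_smul_left, inner_smul_right, conj_trivial,
      nn, real_inner_comm n f]
    linear_combination |Ng| ^ 2 * iff + Nf ^ 2 * sNg
  have vw : (1 - c ^ 2) * inner ℝ v w = -c * (1 - c ^ 2) *
      (1 + |Nf| * inner ℝ m g + |Ng| * inner ℝ n f) ^ 2 - (Ng * Nf) ^ 2 := by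
    rw [hv, hw]
    simp only [inner_add_left, inner_add_right, inner_smul_left, inner_smul_right, conj_trivial,
      mn, real_inner_comm n g, hng, hmf]
    linear_combination |Ng| * |Nf| * igf + Ng * Nf * hab
  have hvw : ‖v‖ * ‖w‖ = inner ℝ v v := by
    have : inner ℝ v v = inner ℝ w w := mul_left_cancel₀ k.ne' (v2.trans w2.symm)
    rw [real_inner_self_eq_norm_sq, real_inner_self_eq_norm_sq] at this
    rw [real_inner_self_eq_norm_sq,
      show ‖w‖ = ‖v‖ from ((sq_eq_sq₀ (norm_nonneg _) (norm_nonneg _)).1 this).symm]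
    ring
  rw [hvw] at hle
  have := mul_le_mul_of_nonneg_left hle k.le
  nlinarith [mul_pos (sub_pos.2 c1) (pow_pos (neg_pos.2 hneg) 2)]

/-- The face of `D` joining the supporting planes at `a₁ = n₁ + c m₁` and `a₂ = n₂ + c m₂` leaves
`m₁` towards `m₂`. -/
theorem IsWideCone.side_of_edge (hD : IsWideCone D c) {m₁ n₁ m₂ n₂ g : E3}
    (h₁ : IsDiam D c m₁ n₁) (h₂ : IsDiam D c m₂ n₂) (hN : det3 m₁ n₁ m₂ ≠ 0) (hg : g ∈ D)
    (g0 : g ≠ 0) (ga₁ : inner ℝ (n₁ + c • m₁) g = 0) (ga₂ : inner ℝ (n₂ + c • m₂) g = 0)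
    (hcase : 0 < inner ℝ (n₂ + c • m₂) m₁ ∨ g = m₂) :
    det3 m₁ n₁ g ≠ 0 ∧ (0 < inner ℝ (m₁ + c • n₁) g → 0 < det3 m₁ n₁ g * det3 m₁ n₁ m₂) := by
  have k := hD.one_sub_sq_pos
  rcases hcase with hpos | rfl
  swap
  · exact ⟨hN, fun _ => mul_self_pos.2 hN⟩
  set N := det3 m₁ n₁ with hNdef
  -- if a nonnegative combination `w` of `g` and `m₂` lies in the plane of `m₁`, `n₁`, it is
  -- orthogonal to `m₁ + c n₁`
  have key : ∀ w ∈ D, inner ℝ (n₂ + c • m₂) w = 0 → N w = 0 →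
      inner ℝ (m₁ + c • n₁) w = 0 := by
    intro w hw hw2 hNw
    have e := h₁.inner_expand (n₂ + c • m₂) w
    rw [hw2, show det3 m₁ n₁ w = 0 from hNw, real_inner_comm (n₂ + c • m₂) m₁,
      real_inner_comm (n₂ + c • m₂) n₁] at e
    have e1 := hD.inner_center_nonneg h₂ h₁.right_mem
    have e2 := hD.inner_left_nonneg h₁ hw
    have e3 := hD.inner_right_nonneg h₁ hw
    rw [inner_add_left, inner_smul_left]
    simp only [conj_trivial]
    nlinarith [mul_nonneg e2 e1, mul_nonneg e3 hpos.le]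
  have hNg : N g ≠ 0 := by
    intro h0
    have h1 := key g hg ga₂ h0
    have e := h₁.inner_expand g g
    rw [inner_add_left, inner_smul_left] at h1 ga₁
    simp only [conj_trivial] at h1 ga₁
    rw [h1, ga₁, show det3 m₁ n₁ g = 0 from h0] at e
    have : inner ℝ g g = 0 := by nlinarith
    exact g0 (inner_self_eq_zero.1 this)
  refine ⟨hNg, fun hb => ?_⟩
  by_contra hneg
  push Not at hneg
  have hneg' : N g * N m₂ < 0 := lt_of_le_of_ne hneg (mul_ne_zero hNg hN)
  have hw : |N m₂| • g + |N g| • m₂ ∈ D :=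
    hD.add_mem _ (hD.smul_mem _ (abs_nonneg _) _ hg) _ (hD.smul_mem _ (abs_nonneg _) _ h₂.left_mem)
  have hNw : N (|N m₂| • g + |N g| • m₂) = 0 := by
    rw [hNdef, det3_add_right, det3_smul_right, det3_smul_right, ← hNdef]
    rcases lt_or_gt_of_ne hNg with h1 | h1
    · have h2 : 0 < N m₂ := by nlinarith
      rw [abs_of_neg h1, abs_of_pos h2]; ring
    · have h2 : N m₂ < 0 := by nlinarith
      rw [abs_of_pos h1, abs_of_neg h2]; ring
  have := key _ hw (by
    rw [inner_add_right, inner_smul_right, inner_smul_right, ga₂, h₂.inner_center_self]; ring) hNw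
  rw [inner_add_right, inner_smul_right, inner_smul_right] at this
  have e3 := hD.inner_center_nonneg h₁.symm h₂.left_mem
  nlinarith [mul_pos (abs_pos.2 hN) hb, mul_nonneg (abs_nonneg (N g)) e3]

/-- Let the supporting planes at `a₁, a₂` and at `b₁, b₂` meet in faces spanned by `g` and `f`.
Then `D` cannot have a proper face at `m₁` towards `m₂` and at `n₁` towards `n₂` at once. -/
theorem IsWideCone.not_both_edges (hD : IsWideCone D c) {m₁ n₁ m₂ n₂ g f : E3}
    (h₁ : IsDiam D c m₁ n₁) (h₂ : IsDiam D c m₂ n₂)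
    (hcr : det3 m₁ n₁ m₂ * det3 m₁ n₁ n₂ < 0)
    (hg : g ∈ D) (hf : f ∈ D) (g0 : g ≠ 0) (f0 : f ≠ 0)
    (ga₁ : inner ℝ (n₁ + c • m₁) g = 0) (ga₂ : inner ℝ (n₂ + c • m₂) g = 0)
    (fb₁ : inner ℝ (m₁ + c • n₁) f = 0) (fb₂ : inner ℝ (m₂ + c • n₂) f = 0)
    (hgc : 0 < inner ℝ (n₂ + c • m₂) m₁ ∨ g = m₂)
    (hfc : 0 < inner ℝ (m₂ + c • n₂) n₁ ∨ f = n₂) : False := by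
  have k := hD.one_sub_sq_pos
  have hm2 : det3 m₁ n₁ m₂ ≠ 0 := fun h => by rw [h, zero_mul] at hcr; exact lt_irrefl _ hcr
  have hn2 : det3 m₁ n₁ n₂ ≠ 0 := fun h => by rw [h, mul_zero] at hcr; exact lt_irrefl _ hcr
  obtain ⟨sg, sg'⟩ := hD.side_of_edge h₁ h₂ hm2 hg g0 ga₁ ga₂ hgc
  obtain ⟨sf, sf'⟩ := hD.side_of_edge h₁.symm h₂.symm
    (by rw [det3_swap_left]; exact neg_ne_zero.2 hn2) hf f0 fb₁ fb₂ hfc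
  rw [det3_swap_left] at sf
  rw [det3_swap_left, det3_swap_left m₁ n₁ n₂, neg_mul_neg] at sf'
  have sf := neg_ne_zero.1 sf
  have opp := hD.not_opposite_faces h₁ hg hf ga₁ fb₁
  have b2eq : det3 m₁ n₁ (m₂ + c • n₂) - c * det3 m₁ n₁ (n₂ + c • m₂)
      = (1 - c ^ 2) * det3 m₁ n₁ m₂ := by
    simp only [det3_add_right, det3_smul_right]; ring
  have a2eq : det3 m₁ n₁ (n₂ + c • m₂) - c * det3 m₁ n₁ (m₂ + c • n₂)
      = (1 - c ^ 2) * det3 m₁ n₁ n₂ := by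
    simp only [det3_add_right, det3_smul_right]; ring
  have expand : ∀ p w : E3, (1 - c ^ 2) * inner ℝ p w = inner ℝ (m₁ + c • n₁) w * inner ℝ p m₁
      + inner ℝ (n₁ + c • m₁) w * inner ℝ p n₁ + det3 m₁ n₁ p * det3 m₁ n₁ w := by
    intro p w
    rw [h₁.inner_expand, inner_add_left, inner_add_left, inner_smul_left, inner_smul_left,
      real_inner_comm p m₁, real_inner_comm p n₁]
    simp
  have gb := hD.inner_center_nonneg h₁.symm hg
  have fa := hD.inner_center_nonneg h₁ hf
  rcases gb.lt_or_eq with gb | gb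
  · rcases fa.lt_or_eq with fa | fa
    · nlinarith [mul_pos (sg' gb) (sf' fa), mul_nonneg opp (neg_nonneg.2 hcr.le)]
    · -- `f` is orthogonal to the plane of `m₁`, `n₁`, which then contains `b₂`
      have hb := expand (m₂ + c • n₂) f
      rw [fb₂, fb₁, ← fa] at hb
      have hb2 : det3 m₁ n₁ (m₂ + c • n₂) = 0 := by
        have : det3 m₁ n₁ (m₂ + c • n₂) * det3 m₁ n₁ f = 0 := by linarith
        exact (mul_eq_zero.1 this).resolve_right sf
      have ha2 : det3 m₁ n₁ (n₂ + c • m₂) ≠ 0 := by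
        rw [hb2] at a2eq
        intro h0; rw [h0] at a2eq
        exact (mul_ne_zero k.ne' hn2) (by linarith)
      have e1 := expand (n₂ + c • m₂) f
      rw [fb₁, ← fa] at e1
      have e2 := expand (n₂ + c • m₂) g
      rw [ga₁, ga₂] at e2
      have e3 := hD.inner_center_nonneg h₂ hf
      have e4 := hD.inner_center_nonneg h₂ h₁.left_mem
      have h5 : 0 < det3 m₁ n₁ (n₂ + c • m₂) * det3 m₁ n₁ f :=
        lt_of_le_of_ne (by nlinarith) (mul_ne_zero ha2 sf).symm
      have h6 : det3 m₁ n₁ (n₂ + c • m₂) * det3 m₁ n₁ g < 0 :=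
        lt_of_le_of_ne (by nlinarith [mul_nonneg gb.le e4]) (mul_ne_zero ha2 sg)
      nlinarith [mul_pos h5 (neg_pos.2 h6),
        mul_nonneg opp (sq_nonneg (det3 m₁ n₁ (n₂ + c • m₂)))]
  · -- `g` is orthogonal to the plane of `m₁`, `n₁`, which then contains `a₂`
    have ha := expand (n₂ + c • m₂) g
    rw [ga₂, ga₁, ← gb] at ha
    have ha2 : det3 m₁ n₁ (n₂ + c • m₂) = 0 := by
      have : det3 m₁ n₁ (n₂ + c • m₂) * det3 m₁ n₁ g = 0 := by linarith
      exact (mul_eq_zero.1 this).resolve_right sg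
    have hb2 : det3 m₁ n₁ (m₂ + c • n₂) ≠ 0 := by
      rw [ha2] at b2eq
      intro h0; rw [h0] at b2eq
      exact (mul_ne_zero k.ne' hm2) (by linarith)
    have e1 := expand (m₂ + c • n₂) g
    rw [ga₁, ← gb] at e1
    have e2 := expand (m₂ + c • n₂) f
    rw [fb₁, fb₂] at e2
    have e3 := hD.inner_center_nonneg h₂.symm hg
    have e4 := hD.inner_center_nonneg h₂.symm h₁.right_mem
    have h5 : 0 < det3 m₁ n₁ (m₂ + c • n₂) * det3 m₁ n₁ g :=
      lt_of_le_of_ne (by nlinarith) (mul_ne_zero hb2 sg).symm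
    have h6 : det3 m₁ n₁ (m₂ + c • n₂) * det3 m₁ n₁ f < 0 :=
      lt_of_le_of_ne (by nlinarith [mul_nonneg fa e4]) (mul_ne_zero hb2 sf)
    nlinarith [mul_pos h5 (neg_pos.2 h6),
      mul_nonneg opp (sq_nonneg (det3 m₁ n₁ (m₂ + c • n₂)))]

/-! ### The cone of supporting hemispheres -/

/-- The cone over the set of centers of the hemispheres containing `C`. -/
def supportCone (C : Set S2) : Set E3 := {v | ∀ p ∈ C, 0 ≤ inner ℝ v (p : E3)}

theorem supportCone_add {C : Set S2} : ∀ v ∈ supportCone C, ∀ w ∈ supportCone C,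
    v + w ∈ supportCone C := by
  intro v hv w hw p hp
  rw [inner_add_left]
  exact add_nonneg (hv p hp) (hw p hp)

theorem supportCone_smul {C : Set S2} : ∀ t : ℝ, 0 ≤ t → ∀ v ∈ supportCone C,
    t • v ∈ supportCone C := by
  intro t ht v hv p hp
  rw [inner_smul_left]
  exact mul_nonneg ht (hv p hp)

theorem norm_coe_S2 (p : S2) : ‖(p : E3)‖ = 1 := by simp

theorem inner_self_S2 (p : S2) : inner ℝ (p : E3) (p : E3) = 1 :=
  inner_self_of_norm_one (norm_coe_S2 p)

theorem inner_le_one_S2 (p q : S2) : inner ℝ (p : E3) (q : E3) ≤ 1 := by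
  simpa using real_inner_le_norm (p : E3) (q : E3)

theorem neg_one_le_inner_S2 (p q : S2) : -1 ≤ inner ℝ (p : E3) (q : E3) := by
  have := abs_le.1 (abs_real_inner_le_norm (p : E3) (q : E3))
  simpa using this.1

/-- The point of the sphere in the direction of a nonzero vector. -/
noncomputable def direction (v : E3) (hv : v ≠ 0) : S2 :=
  ⟨‖v‖⁻¹ • v, by
    have : ‖v‖ ≠ 0 := norm_ne_zero_iff.mpr hv
    simp [norm_smul, this]⟩

theorem norm_smul_direction (v : E3) (hv : v ≠ 0) : ‖v‖ • (direction v hv : E3) = v := by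
  have : ‖v‖ ≠ 0 := norm_ne_zero_iff.mpr hv
  simp [direction, smul_smul, this]

theorem exists_orthogonal (x : E3) : ∃ p : S2, inner ℝ x (p : E3) = 0 := by
  suffices ∃ p : E3, p ≠ 0 ∧ inner ℝ x p = 0 by
    obtain ⟨p, hp, h⟩ := this
    refine ⟨direction p hp, ?_⟩
    simp [direction, inner_smul_right, h]
  by_cases h : x 0 = 0
  · exact ⟨!₂[1, 0, 0], fun h0 => by simpa using congrArg (fun v : E3 => v 0) h0,
      by simp [inner_eq_coord, h]⟩
  · refine ⟨!₂[-x 1, x 0, 0], fun h0 => h (by simpa using congrArg (fun v : E3 => v 1) h0), ?_⟩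
    simp [inner_eq_coord]; ring

namespace IsConvexBody

variable {C : Set S2}

theorem nonempty (hC : IsConvexBody C) : C.Nonempty := hC.2.2.mono interior_subset

theorem isCompact (hC : IsConvexBody C) : IsCompact C := hC.1.isCompact

theorem direction_add_mem (hC : IsConvexBody C) {p q : S2} (hp : p ∈ C) (hq : q ∈ C) {s t : ℝ}
    (hs : 0 ≤ s) (ht : 0 ≤ t) (h0 : s • (p : E3) + t • (q : E3) ≠ 0) :
    direction (s • (p : E3) + t • (q : E3)) h0 ∈ C := by
  refine hC.2.1.2 p hp q hq ⟨‖s • (p : E3) + t • (q : E3)‖⁻¹ * s,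
    ‖s • (p : E3) + t • (q : E3)‖⁻¹ * t, by positivity, by positivity, ?_⟩
  rw [mul_smul, mul_smul, ← smul_add]
  rfl

/-- The closed convex cone spanned by a convex body. -/
def toProperCone (hC : IsConvexBody C) : ProperCone ℝ E3 where
  carrier := {x | ∃ z : S2, z ∈ C ∧ x = ‖x‖ • (z : E3)}
  zero_mem' := by
    obtain ⟨z, hz⟩ := hC.nonempty
    exact ⟨z, hz, by simp⟩
  add_mem' := by
    rintro x y ⟨z, hz, hx⟩ ⟨w, hw, hy⟩
    by_cases h0 : x + y = 0
    · exact ⟨z, hz, by simp [h0]⟩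
    · rw [hx, hy] at h0 ⊢
      exact ⟨_, hC.direction_add_mem hz hw (norm_nonneg _) (norm_nonneg _) h0,
        (norm_smul_direction _ h0).symm⟩
  smul_mem' := by
    rintro t x ⟨z, hz, hx⟩
    refine ⟨z, hz, ?_⟩
    have : ‖(t : ℝ) • x‖ = (t : ℝ) * ‖x‖ := by
      rw [norm_smul, Real.norm_of_nonneg t.2]
    change (t : ℝ) • x = ‖(t : ℝ) • x‖ • (z : E3)
    rw [this, mul_smul, ← hx]
  isClosed' := by
    have h1 : IsClosed {x : E3 × S2 | x.2 ∈ C ∧ x.1 = ‖x.1‖ • (x.2 : E3)} := by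
      refine (hC.1.preimage continuous_snd).inter (isClosed_eq continuous_fst ?_)
      fun_prop
    have h2 := isClosedMap_fst_of_compactSpace _ h1
    convert h2 using 1
    ext x
    constructor
    · rintro ⟨z, hz, hx⟩
      exact ⟨(x, z), ⟨hz, hx⟩, rfl⟩
    · rintro ⟨⟨x', z⟩, ⟨hz, hx⟩, rfl⟩
      exact ⟨z, hz, hx⟩

theorem mem_toProperCone (hC : IsConvexBody C) {x : E3} :
    x ∈ hC.toProperCone ↔ ∃ z : S2, z ∈ C ∧ x = ‖x‖ • (z : E3) := Iff.rfl

theorem coe_mem_toProperCone (hC : IsConvexBody C) {z : S2} (hz : z ∈ C) :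
    (z : E3) ∈ hC.toProperCone := hC.mem_toProperCone.2 ⟨z, hz, by simp⟩

theorem exists_separating (hC : IsConvexBody C) {x : E3} (hx : x ∉ hC.toProperCone) :
    ∃ y ∈ supportCone C, inner ℝ x y < 0 := by
  obtain ⟨y, hy, hxy⟩ := ProperCone.hyperplane_separation' hC.toProperCone hx
  refine ⟨y, fun p hp => ?_, hxy⟩
  rw [real_inner_comm]
  exact hy _ (hC.coe_mem_toProperCone hp)

/-- The bipolar theorem for the cone over a convex body. -/
theorem mem_of_forall_supportCone (hC : IsConvexBody C) {p : S2}
    (h : ∀ d ∈ supportCone C, 0 ≤ inner ℝ (p : E3) d) : p ∈ C := by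
  have hp : (p : E3) ∈ hC.toProperCone := by
    by_contra hp
    obtain ⟨y, hy, hpy⟩ := hC.exists_separating hp
    exact absurd (h y hy) (not_le.2 hpy)
  obtain ⟨z, hz, hpz⟩ := hC.mem_toProperCone.1 hp
  rw [norm_coe_S2, one_smul] at hpz
  rwa [Subtype.ext hpz]

/-- A convex body lies in an open hemisphere. -/
theorem exists_pos (hC : IsConvexBody C) : ∃ u : E3, ∀ p ∈ C, 0 < inner ℝ u (p : E3) := by
  suffices ∃ u ∈ supportCone C, ∀ p ∈ C, 0 < inner ℝ u (p : E3) from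
    this.imp fun u hu => hu.2
  refine hC.isCompact.induction_on (p := fun s => ∃ u ∈ supportCone C,
    ∀ p ∈ C, p ∈ s → 0 < inner ℝ u (p : E3)) ⟨0, fun p _ => by simp, by simp⟩ ?_ ?_ ?_ |>.imp
      fun u hu => ⟨hu.1, fun p hp => hu.2 p hp hp⟩
  · rintro s t hst ⟨u, hu, h⟩
    exact ⟨u, hu, fun p hpC hp => h p hpC (hst hp)⟩
  · rintro s t ⟨u, hu, h⟩ ⟨w, hw, h'⟩
    refine ⟨u + w, supportCone_add u hu w hw, fun p hpC hp => ?_⟩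
    rw [inner_add_left]
    rcases hp with hp | hp
    · exact add_pos_of_pos_of_nonneg (h p hpC hp) (hw p hpC)
    · exact add_pos_of_nonneg_of_pos (hu p hpC) (h' p hpC hp)
  · intro z hz
    have hz' : -(z : E3) ∉ hC.toProperCone := by
      intro hmem
      obtain ⟨w, hw, h⟩ := hC.mem_toProperCone.1 hmem
      rw [norm_neg, norm_coe_S2, one_smul] at h
      have : w = -z := Subtype.ext (by simpa using h.symm)
      exact hC.2.1.1 z hz (this ▸ hw)
    obtain ⟨y, hy, h⟩ := hC.exists_separating hz'
    rw [inner_neg_left, neg_lt_zero, real_inner_comm] at h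
    refine ⟨{p : S2 | 0 < inner ℝ y (p : E3)}, mem_nhdsWithin_of_mem_nhds ?_, y, hy,
      fun p _ hp => hp⟩
    exact (isOpen_lt continuous_const (by fun_prop)).mem_nhds h

/-- Supporting vectors are positive on the interior. -/
theorem inner_pos_of_mem_interior {p : S2} (hp : p ∈ interior C) {v : E3}
    (hv : v ∈ supportCone C) (hv0 : v ≠ 0) : 0 < inner ℝ (p : E3) v := by
  have h0 := hv p (interior_subset hp)
  rw [real_inner_comm] at h0
  refine lt_of_le_of_ne h0 fun h => ?_
  have hne : ∀ t : ℝ, (p : E3) - t • v ≠ 0 := by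
    intro t ht
    have := congrArg (fun x => inner ℝ (p : E3) x) ht
    simp only [inner_sub_right, inner_smul_right, ← h, inner_self_S2, inner_zero_right] at this
    norm_num at this
  have hcont : Continuous fun t : ℝ => direction ((p : E3) - t • v) (hne t) := by
    have h1 : Continuous fun t : ℝ => (p : E3) - t • v := by fun_prop
    exact Continuous.subtype_mk
      ((h1.norm.inv₀ fun t => norm_ne_zero_iff.2 (hne t)).smul h1) _
  have hp0 : direction ((p : E3) - (0 : ℝ) • v) (hne 0) = p := by
    apply Subtype.ext
    simp [direction]
  have hev : ∀ᶠ t : ℝ in nhds 0, direction ((p : E3) - t • v) (hne t) ∈ interior C :=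
    hcont.continuousAt.eventually_mem (by rw [hp0]; exact isOpen_interior.mem_nhds hp)
  obtain ⟨t, ht, htpos⟩ := ((hev.filter_mono nhdsWithin_le_nhds).and
    (self_mem_nhdsWithin (s := Set.Ioi (0 : ℝ)))).exists
  have h1 := hv _ (interior_subset ht)
  simp only [direction, inner_smul_right, inner_sub_right] at h1
  rw [real_inner_comm (p : E3) v, ← h] at h1
  have h2 : 0 < ‖(p : E3) - t • v‖⁻¹ := inv_pos.2 (norm_pos_iff.2 (hne t))
  have h3 : 0 < inner ℝ v v := real_inner_self_pos.2 hv0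
  have h4 : (0 : ℝ) < t := htpos
  nlinarith [mul_pos h2 (mul_pos h4 h3)]

theorem mem_frontier (hC : IsConvexBody C) {p : S2} (hp : p ∈ C) {v : E3}
    (hv : v ∈ supportCone C) (hv0 : v ≠ 0) (h : inner ℝ v (p : E3) = 0) : p ∈ frontier C := by
  rw [hC.1.frontier_eq]
  refine ⟨hp, fun hi => ?_⟩
  have := inner_pos_of_mem_interior hi hv hv0
  rw [real_inner_comm, h] at this
  exact lt_irrefl _ this

theorem supports (hC : IsConvexBody C) {m p : S2} (hm : (m : E3) ∈ supportCone C) (hp : p ∈ C)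
    (h : inner ℝ (m : E3) (p : E3) = 0) : Supports C m :=
  ⟨hm, p, hC.mem_frontier hp hm (by simp [← norm_ne_zero_iff]) h, h⟩

theorem isLunePair (hC : IsConvexBody C) {x y : S2} (hx : (x : E3) ∈ supportCone C)
    (hy : (y : E3) ∈ supportCone C) (hxy : x ≠ y) : IsLunePair x y := by
  refine ⟨hxy, fun h => ?_⟩
  obtain ⟨p, hp⟩ := hC.2.2
  have h1 := inner_pos_of_mem_interior hp hx (by simp [← norm_ne_zero_iff])
  have h2 := inner_pos_of_mem_interior hp hy (by simp [← norm_ne_zero_iff])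
  rw [h] at h1
  simp at h1
  linarith

end IsConvexBody

theorem IsLunePair.symm {g h : S2} (hl : IsLunePair g h) : IsLunePair h g :=
  ⟨hl.1.symm, fun e => hl.2 (by rw [e, neg_neg])⟩

theorem norm_smul_semicircleCenter {g h : S2} (hl : IsLunePair g h) :
    ‖orthPart g h‖ • (semicircleCenter g h : E3) = orthPart g h := by
  have hv := orthPart_ne_zero hl
  have : ‖orthPart g h‖ ≠ 0 := norm_ne_zero_iff.mpr hv
  simp [semicircleCenter, hv, smul_smul, this]

theorem inner_orthPart_self (g h : S2) : inner ℝ (g : E3) (orthPart g h) = 0 := by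
  rw [orthPart, inner_sub_right, inner_smul_right, inner_self_S2]; ring

theorem norm_orthPart_sq (g h : S2) :
    ‖orthPart g h‖ ^ 2 = 1 - inner ℝ (g : E3) (h : E3) ^ 2 := by
  rw [← real_inner_self_eq_norm_sq]
  conv_lhs => rw [orthPart]
  rw [inner_sub_left, inner_smul_left, ← orthPart, inner_orthPart_self, orthPart, inner_sub_right,
    inner_smul_right, inner_self_S2, real_inner_comm]
  simp; ring

theorem luneThickness_eq {g h : S2} (hl : IsLunePair g h) :
    luneThickness g h = Real.arccos (-inner ℝ (g : E3) (h : E3)) := by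
  rw [luneThickness, sphDist, InnerProductGeometry.angle]
  congr 1
  rw [norm_coe_S2, norm_coe_S2, mul_one, div_one]
  have h1 := norm_orthPart_sq g h
  have h2 := norm_orthPart_sq h g
  rw [real_inner_comm] at h2
  have hpos : 0 < ‖orthPart g h‖ := norm_pos_iff.2 (orthPart_ne_zero hl)
  have heq : ‖orthPart h g‖ = ‖orthPart g h‖ :=
    (sq_eq_sq₀ (norm_nonneg _) (norm_nonneg _)).1 (h2.trans h1.symm)
  have h3 : inner ℝ (orthPart g h) (orthPart h g) = -inner ℝ (g : E3) (h : E3) *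
      ‖orthPart g h‖ ^ 2 := by
    rw [h1, orthPart, orthPart]
    simp only [inner_sub_left, inner_sub_right, inner_smul_left, inner_smul_right, inner_self_S2,
      real_inner_comm (g : E3) (h : E3), conj_trivial]
    ring
  rw [← norm_smul_semicircleCenter hl, ← norm_smul_semicircleCenter hl.symm, inner_smul_left,
    inner_smul_right, heq, norm_smul, norm_coe_S2] at h3
  simp only [conj_trivial, norm_norm, mul_one] at h3
  have h4 : ‖orthPart g h‖ ^ 2 ≠ 0 := (pow_pos hpos 2).ne'
  apply mul_left_cancel₀ h4
  linarith

theorem inner_ne_of_isLunePair {g h : S2} (hl : IsLunePair g h) :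
    inner ℝ (g : E3) (h : E3) < 1 ∧ -1 < inner ℝ (g : E3) (h : E3) := by
  have h1 := norm_orthPart_sq g h
  have h2 : 0 < ‖orthPart g h‖ := norm_pos_iff.2 (orthPart_ne_zero hl)
  constructor <;> nlinarith [inner_le_one_S2 g h, neg_one_le_inner_S2 g h, pow_pos h2 2]

/-- The centers `x`, `y` of two hemispheres containing `C` are as far from each other as
possible. -/
structure IsFarthest (C : Set S2) (x y : S2) : Prop where
  left_mem : (x : E3) ∈ supportCone C
  right_mem : (y : E3) ∈ supportCone C
  ne : x ≠ y
  inner_le : ∀ v ∈ supportCone C, ∀ w ∈ supportCone C,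
    inner ℝ (x : E3) (y : E3) * (‖v‖ * ‖w‖) ≤ inner ℝ v w

theorem IsFarthest.symm {C : Set S2} {x y : S2} (h : IsFarthest C x y) : IsFarthest C y x :=
  ⟨h.right_mem, h.left_mem, h.ne.symm, fun v hv w hw => by
    rw [real_inner_comm]; exact h.inner_le v hv w hw⟩

namespace IsConvexBody

variable {C : Set S2}

theorem exists_isFarthest (hC : IsConvexBody C) : ∃ x y, IsFarthest C x y := by
  set S : Set S2 := {m | (m : E3) ∈ supportCone C} with hS
  have hclosed : IsClosed S := by
    have : S = ⋂ p ∈ C, {m : S2 | 0 ≤ inner ℝ (m : E3) (p : E3)} := by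
      ext m; simp [hS, supportCone]
    rw [this]
    exact isClosed_biInter fun p _ => isClosed_le continuous_const (by fun_prop)
  obtain ⟨u, hu⟩ := hC.exists_pos
  obtain ⟨z, hz⟩ := hC.nonempty
  have dirmem : ∀ v ∈ supportCone C, ∀ hv0 : v ≠ 0, direction v hv0 ∈ S := fun v hv hv0 =>
    supportCone_smul _ (by positivity) v hv
  have hu0 : u ≠ 0 := by
    rintro rfl
    simpa using hu z hz
  have hne : S.Nonempty := ⟨_, dirmem u (fun p hp => (hu p hp).le) hu0⟩
  obtain ⟨⟨x, y⟩, ⟨hx, hy⟩, hmin⟩ := (hclosed.isCompact.prod hclosed.isCompact).exists_isMinOn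
    (hne.prod hne) (f := fun q : S2 × S2 => inner ℝ (q.1 : E3) (q.2 : E3)) (by fun_prop)
  have hle : ∀ v ∈ supportCone C, ∀ w ∈ supportCone C,
      inner ℝ (x : E3) (y : E3) * (‖v‖ * ‖w‖) ≤ inner ℝ v w := by
    intro v hv w hw
    by_cases hv0 : v = 0
    · simp [hv0]
    by_cases hw0 : w = 0
    · simp [hw0]
    have h1 := isMinOn_iff.1 hmin (direction v hv0, direction w hw0)
      ⟨dirmem v hv hv0, dirmem w hw hw0⟩
    simp only at h1
    rw [← norm_smul_direction v hv0, ← norm_smul_direction w hw0, inner_smul_left,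
      inner_smul_right, norm_smul, norm_smul, norm_coe_S2, norm_coe_S2]
    simp only [norm_norm, mul_one, conj_trivial]
    have h2 : 0 ≤ ‖v‖ * ‖w‖ := by positivity
    nlinarith
  refine ⟨x, y, hx, hy, fun hxy => ?_, hle⟩
  -- if `x` were the only center, `C` would be a hemisphere, which contains antipodes
  have hx' : ∀ d ∈ supportCone C, d = ‖d‖ • (x : E3) := by
    intro d hd
    by_cases hd0 : d = 0
    · simp [hd0]
    have h1 := hle x hx _ (dirmem d hd hd0)
    rw [← hxy, inner_self_S2, norm_coe_S2, norm_coe_S2, mul_one, mul_one] at h1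
    have h2 := eq_of_inner_eq_one (norm_coe_S2 x) (norm_coe_S2 _)
      (le_antisymm (inner_le_one_S2 x _) h1)
    rw [h2, norm_smul_direction]
  obtain ⟨p, hp⟩ := exists_orthogonal (x : E3)
  rw [real_inner_comm] at hp
  have hpC : p ∈ C := hC.mem_of_forall_supportCone fun d hd => by
    rw [hx' d hd, inner_smul_right, hp, mul_zero]
  have hpC' : -p ∈ C := hC.mem_of_forall_supportCone fun d hd => by
    rw [hx' d hd, inner_smul_right]
    simp [hp]
  exact hC.2.1.1 p hpC hpC'

variable {x y : S2}

theorem semicircleCenter_mem (hC : IsConvexBody C) (h : IsFarthest C x y) :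
    semicircleCenter x y ∈ C := by
  have hl := hC.isLunePair h.left_mem h.right_mem h.ne
  refine hC.mem_of_forall_supportCone fun d hd => ?_
  have h1 := inner_sub_nonneg_of_isMin supportCone_add supportCone_smul (x := (y : E3))
    (y := (x : E3)) h.left_mem (norm_coe_S2 x) rfl (μ := inner ℝ (y : E3) (x : E3))
    (fun d hd => by simpa [real_inner_comm] using h.inner_le y h.right_mem d hd) hd
  have h2 : (y : E3) - inner ℝ (y : E3) (x : E3) • (x : E3) = orthPart x y := by
    rw [orthPart, real_inner_comm]
  rw [h2, ← norm_smul_semicircleCenter hl, inner_smul_left] at h1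
  exact nonneg_of_mul_nonneg_right h1 (norm_pos_iff.2 (orthPart_ne_zero hl))

theorem supports_left (hC : IsConvexBody C) (h : IsFarthest C x y) : Supports C x :=
  hC.supports h.left_mem (hC.semicircleCenter_mem h)
    (semicircleCenter_spec (hC.isLunePair h.left_mem h.right_mem h.ne)).1

theorem luneThickness_nonneg (g h : S2) : 0 ≤ luneThickness g h :=
  InnerProductGeometry.angle_nonneg _ _

theorem width_le {k h : S2} (hh : Supports C h) (hl : IsLunePair k h) :
    width C k ≤ luneThickness k h :=
  csInf_le ⟨0, by rintro _ ⟨h', _, _, rfl⟩; exact luneThickness_nonneg _ _⟩ ⟨h, hh, hl, rfl⟩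

theorem width_nonneg (C : Set S2) (k : S2) : 0 ≤ width C k :=
  Real.sInf_nonneg (by rintro _ ⟨h', _, _, rfl⟩; exact luneThickness_nonneg _ _)

theorem thickness_eq (hC : IsConvexBody C) (h : IsFarthest C x y) :
    thickness C = Real.arccos (-inner ℝ (x : E3) (y : E3)) := by
  have hl := hC.isLunePair h.left_mem h.right_mem h.ne
  apply le_antisymm
  · refine le_trans (csInf_le ⟨0, ?_⟩ ⟨x, hC.supports_left h, rfl⟩) ?_
    · rintro _ ⟨k, _, rfl⟩; exact width_nonneg C k
    · rw [← luneThickness_eq hl]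
      exact width_le (hC.supports_left h.symm) hl
  · refine le_csInf ⟨_, x, hC.supports_left h, rfl⟩ ?_
    rintro _ ⟨k, hk, rfl⟩
    refine le_csInf ?_ ?_
    · by_cases hkx : k = x
      · exact ⟨_, y, hC.supports_left h.symm, hkx ▸ hl, rfl⟩
      · exact ⟨_, x, hC.supports_left h, hC.isLunePair hk.1 h.left_mem hkx, rfl⟩
    · rintro _ ⟨k', hk', hlk, rfl⟩
      rw [luneThickness_eq hlk]
      apply Real.arccos_le_arccos
      have := h.inner_le k hk.1 k' hk'.1
      simp only [norm_coe_S2, mul_one] at this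
      linarith

theorem cos_thickness (hC : IsConvexBody C) (h : IsFarthest C x y) :
    Real.cos (thickness C) = -inner ℝ (x : E3) (y : E3) := by
  rw [hC.thickness_eq h, Real.cos_arccos]
  · linarith [inner_le_one_S2 x y]
  · linarith [neg_one_le_inner_S2 x y]

theorem thickness_nonneg (hC : IsConvexBody C) : 0 ≤ thickness C := by
  obtain ⟨x, y, h⟩ := hC.exists_isFarthest
  rw [hC.thickness_eq h]
  exact Real.arccos_nonneg _

theorem thickness_le_pi (hC : IsConvexBody C) : thickness C ≤ Real.pi := by
  obtain ⟨x, y, h⟩ := hC.exists_isFarthest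
  rw [hC.thickness_eq h]
  exact Real.arccos_le_pi _

theorem isWideCone (hC : IsConvexBody C) (hΔ : thickness C < Real.pi / 2) :
    IsWideCone (supportCone C) (Real.cos (thickness C)) := by
  obtain ⟨x, y, h⟩ := hC.exists_isFarthest
  have hl := hC.isLunePair h.left_mem h.right_mem h.ne
  refine ⟨?_, ?_, supportCone_add, supportCone_smul, ?_, ?_⟩
  · exact Real.cos_pos_of_mem_Ioo ⟨by linarith [hC.thickness_nonneg, Real.pi_pos], hΔ⟩
  · rw [hC.cos_thickness h]
    linarith [(inner_ne_of_isLunePair hl).2]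
  · obtain ⟨p, hp⟩ := hC.2.2
    exact ⟨p, fun v hv hv0 => inner_pos_of_mem_interior hp hv hv0⟩
  · rw [hC.cos_thickness h, neg_neg]
    exact h.inner_le

theorem isDiam_of_isStar {m n : S2} (hm : Supports C m)
    (hw : width C m = thickness C) (hn : IsStar C m n) :
    IsDiam (supportCone C) (Real.cos (thickness C)) m n := by
  have h1 : width C m = luneThickness m n := by
    apply le_antisymm (width_le hn.1 hn.2.1)
    refine le_csInf ⟨_, n, hn.1, hn.2.1, rfl⟩ ?_
    rintro _ ⟨h', hs, hl, rfl⟩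
    exact hn.2.2 h' hs hl
  refine ⟨hm.1, hn.1.1, norm_coe_S2 m, norm_coe_S2 n, ?_⟩
  rw [← hw, h1, luneThickness_eq hn.2.1, Real.cos_arccos, neg_neg]
  · linarith [inner_le_one_S2 m n]
  · linarith [neg_one_le_inner_S2 m n]

theorem isFarthest_of_isDiam (hC : IsConvexBody C) (hΔ : thickness C < Real.pi / 2) {m n : S2}
    (h : IsDiam (supportCone C) (Real.cos (thickness C)) m n) : IsFarthest C m n := by
  have hD := hC.isWideCone hΔ
  refine ⟨h.left_mem, h.right_mem, ?_, ?_⟩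
  · rintro rfl
    have := h.inner_eq
    rw [inner_self_S2] at this
    linarith [hD.c_pos]
  · rw [h.inner_eq]
    exact hD.le_inner

theorem width_le_thickness (hC : IsConvexBody C) (hΔ : thickness C < Real.pi / 2) {m n : S2}
    (h : IsDiam (supportCone C) (Real.cos (thickness C)) m n) : width C m ≤ thickness C := by
  have hf := hC.isFarthest_of_isDiam hΔ h
  have hl := hC.isLunePair hf.left_mem hf.right_mem hf.ne
  refine (width_le (hC.supports_left hf.symm) hl).trans_eq ?_
  rw [luneThickness_eq hl, hC.thickness_eq hf]

theorem exists_ne_mem_interior (hC : IsConvexBody C) (e : S2) : ∃ z ∈ interior C, z ≠ e := by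
  by_contra! hcon
  have heq : interior C = {e} :=
    Set.eq_singleton_iff_nonempty_unique_mem.2 ⟨hC.2.2, hcon⟩
  have hconn : IsConnected (Metric.sphere (0 : E3) 1) :=
    isConnected_sphere (by
      rw [← Module.finrank_eq_rank, finrank_euclideanSpace_fin]; norm_num) _ zero_le_one
  have : ConnectedSpace S2 := isConnected_iff_connectedSpace.1 hconn
  have hclopen : IsClopen ({e} : Set S2) := ⟨isClosed_singleton, heq ▸ isOpen_interior⟩
  have huniv := hclopen.eq_univ (Set.singleton_nonempty e)
  have : -e ∈ ({e} : Set S2) := huniv ▸ Set.mem_univ _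
  have h1 := congrArg (fun p : S2 => inner ℝ (p : E3) (e : E3)) (Set.mem_singleton_iff.1 this)
  simp only [inner_self_S2] at h1
  simp at h1
  norm_num at h1

end IsConvexBody

/-! ### Reduced bodies have many diametral pairs -/

namespace IsReduced

variable {R : Set S2}

/-- Let `φ z = z / ⟪u, z⟫` be the central projection to the plane `⟪u, ·⟫ = 1`, and let `e` be
strongly exposed in the image of `R`, as witnessed by `v`. Cutting off a small cap of `R` at `e`
yields a smaller convex body; two farthest supporting hemispheres of it have an angle exceeding the
largest one possible for `R`, so one of them, `x`, cuts the cap, and the center of its semicircle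
lies near `e`. -/
theorem exists_cap_pair (hR : IsReduced R) {u v : E3} {e : S2} (he : e ∈ R)
    (hu : ∀ p ∈ R, 0 < inner ℝ u (p : E3))
    (hv : ∀ z ∈ R, ‖(inner ℝ u (z : E3))⁻¹ • (z : E3) - (inner ℝ u (e : E3))⁻¹ • (e : E3)‖ ^ 2 ≤
      2 * (inner ℝ v ((inner ℝ u (e : E3))⁻¹ • (e : E3))
        - inner ℝ v ((inner ℝ u (z : E3))⁻¹ • (z : E3))))
    {δ : ℝ} (hδ : 0 < δ) {z₀ : S2} (hz₀ : z₀ ∈ interior R)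
    (hδz : δ < inner ℝ v ((inner ℝ u (e : E3))⁻¹ • (e : E3))
      - inner ℝ v ((inner ℝ u (z₀ : E3))⁻¹ • (z₀ : E3))) :
    ∃ x y a : S2, ∃ ρ : ℝ,
      (∀ z ∈ R, δ ≤ inner ℝ v ((inner ℝ u (e : E3))⁻¹ • (e : E3))
        - inner ℝ v ((inner ℝ u (z : E3))⁻¹ • (z : E3)) →
        0 ≤ inner ℝ (x : E3) (z : E3) ∧ 0 ≤ inner ℝ (y : E3) (z : E3)) ∧
      inner ℝ (x : E3) (y : E3) ≤ -Real.cos (thickness R) ∧ a ∈ R ∧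
      0 ≤ inner ℝ (x : E3) (a : E3) ∧ 0 ≤ inner ℝ (y : E3) (a : E3) ∧
      0 ≤ ρ ∧ orthPart x y = ρ • (a : E3) ∧
      ‖(inner ℝ u (a : E3))⁻¹ • (a : E3) - (inner ℝ u (e : E3))⁻¹ • (e : E3)‖ ^ 2 ≤ 2 * δ := by
  set E := inner ℝ v ((inner ℝ u (e : E3))⁻¹ • (e : E3)) with hE
  set w : E3 := (E - δ) • u - v with hw
  have iw : ∀ z ∈ R, inner ℝ w (z : E3) =
      inner ℝ u (z : E3) * (E - inner ℝ v ((inner ℝ u (z : E3))⁻¹ • (z : E3)) - δ) := by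
    intro z hz
    rw [hw, inner_sub_left, inner_smul_left, inner_smul_right]
    have := (hu z hz).ne'
    simp only [conj_trivial]
    field_simp
    ring
  have hwe : inner ℝ w (e : E3) < 0 := by
    rw [iw e he, ← hE]
    nlinarith [hu e he]
  set Z : Set S2 := R ∩ {z | 0 ≤ inner ℝ w (z : E3)} with hZ
  have hZR : Z ⊆ R := Set.inter_subset_left
  have hconv : IsSphConvex Z := by
    refine ⟨fun p hp hp' => hR.1.2.1.1 p hp.1 hp'.1, fun p hp q hq z hz => ⟨?_, ?_⟩⟩
    · exact hR.1.2.1.2 p hp.1 q hq.1 hz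
    · obtain ⟨s, t, hs, ht, h⟩ := hz
      change 0 ≤ inner ℝ w (z : E3)
      rw [h, inner_add_right, inner_smul_right, inner_smul_right]
      exact add_nonneg (mul_nonneg hs hp.2) (mul_nonneg ht hq.2)
  have hZbody : IsConvexBody Z := by
    refine ⟨hR.1.1.inter (isClosed_le continuous_const (by fun_prop)), hconv, z₀, ?_⟩
    have hopen : IsOpen (interior R ∩ {z : S2 | 0 < inner ℝ w (z : E3)}) :=
      isOpen_interior.inter (isOpen_lt continuous_const (by fun_prop))
    refine interior_maximal (Set.inter_subset_inter interior_subset fun z hz => ?_) hopen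
      ⟨hz₀, ?_⟩
    · exact le_of_lt (show 0 < inner ℝ w (z : E3) from hz)
    · change 0 < inner ℝ w (z₀ : E3)
      have hz₀R := interior_subset hz₀
      rw [iw z₀ hz₀R]
      exact mul_pos (hu z₀ hz₀R) (by linarith)
  have hZne : Z ≠ R := fun h => by
    have : e ∈ Z := h ▸ he
    exact absurd this.2 (not_le.2 hwe)
  have hth := hR.2 Z hZbody hZR hZne
  have main : ∀ x y : S2, IsFarthest Z x y → (x : E3) ∉ supportCone R →
      ∃ x y a : S2, ∃ ρ : ℝ,
      (∀ z ∈ R, δ ≤ E - inner ℝ v ((inner ℝ u (z : E3))⁻¹ • (z : E3)) →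
        0 ≤ inner ℝ (x : E3) (z : E3) ∧ 0 ≤ inner ℝ (y : E3) (z : E3)) ∧
      inner ℝ (x : E3) (y : E3) ≤ -Real.cos (thickness R) ∧ a ∈ R ∧
      0 ≤ inner ℝ (x : E3) (a : E3) ∧ 0 ≤ inner ℝ (y : E3) (a : E3) ∧
      0 ≤ ρ ∧ orthPart x y = ρ • (a : E3) ∧
      ‖(inner ℝ u (a : E3))⁻¹ • (a : E3) - (inner ℝ u (e : E3))⁻¹ • (e : E3)‖ ^ 2 ≤ 2 * δ := by
    intro x y hf hx
    have hl := hZbody.isLunePair hf.left_mem hf.right_mem hf.ne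
    have haZ := hZbody.semicircleCenter_mem hf
    set a := semicircleCenter x y with ha
    refine ⟨x, y, a, ‖orthPart x y‖, fun z hz hδz => ?_, ?_, hZR haZ, hf.left_mem a haZ,
      hf.right_mem a haZ, norm_nonneg _, (norm_smul_semicircleCenter hl).symm, ?_⟩
    · have : z ∈ Z := ⟨hz, by
        change 0 ≤ inner ℝ w (z : E3)
        rw [iw z hz]
        exact mul_nonneg (hu z hz).le (by linarith)⟩
      exact ⟨hf.left_mem z this, hf.right_mem z this⟩
    · have h1 := Real.cos_le_cos_of_nonneg_of_le_pi hZbody.thickness_nonneg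
        hR.1.thickness_le_pi hth.le
      rw [hZbody.cos_thickness hf] at h1
      linarith
    · by_contra hcon
      push Not at hcon
      have hwa : 0 < inner ℝ w (a : E3) := by
        rw [iw a (hZR haZ)]
        refine mul_pos (hu a (hZR haZ)) ?_
        have := hv a (hZR haZ)
        linarith
      -- points of `R` cut off by `x` exist arbitrarily close to `a`, but `a` is away from the cap
      simp only [supportCone, Set.mem_ofPred_eq, not_forall, not_le] at hx
      obtain ⟨p, hp, hxp⟩ := hx
      set τ := inner ℝ w (a : E3) / (1 + |inner ℝ w (p : E3)|) with hτ
      have hτpos : 0 < τ := by positivity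
      have hxa : inner ℝ (x : E3) (a : E3) = 0 := (semicircleCenter_spec hl).1
      have hne : (1 : ℝ) • (a : E3) + τ • (p : E3) ≠ 0 := by
        intro h0
        have := congrArg (fun q : E3 => inner ℝ (x : E3) q) h0
        simp only [inner_add_right, inner_smul_right, hxa, inner_zero_right] at this
        nlinarith [mul_pos hτpos (neg_pos.2 hxp)]
      have hqR := hR.1.direction_add_mem (hZR haZ) hp zero_le_one hτpos.le hne
      have hnpos : 0 < ‖(1 : ℝ) • (a : E3) + τ • (p : E3)‖⁻¹ := inv_pos.2 (norm_pos_iff.2 hne)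
      have hqZ : direction ((1 : ℝ) • (a : E3) + τ • (p : E3)) hne ∈ Z := by
        refine ⟨hqR, ?_⟩
        change 0 ≤ inner ℝ w (direction _ hne : E3)
        simp only [direction, inner_smul_right, inner_add_right]
        refine mul_nonneg hnpos.le ?_
        have h1 : τ * (1 + |inner ℝ w (p : E3)|) = inner ℝ w (a : E3) :=
          div_mul_cancel₀ _ (by positivity)
        nlinarith [neg_abs_le (inner ℝ w (p : E3)), mul_nonneg hτpos.le
          (show 0 ≤ inner ℝ w (p : E3) + |inner ℝ w (p : E3)| by
            linarith [neg_abs_le (inner ℝ w (p : E3))])]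
      have h2 := hf.left_mem _ hqZ
      simp only [direction, inner_smul_right, inner_add_right, hxa] at h2
      nlinarith [mul_pos hnpos (mul_pos hτpos (neg_pos.2 hxp))]
  obtain ⟨x, y, hf⟩ := hZbody.exists_isFarthest
  by_cases hx : (x : E3) ∈ supportCone R
  · by_cases hy : (y : E3) ∈ supportCone R
    · exfalso
      obtain ⟨x', y', hf'⟩ := hR.1.exists_isFarthest
      have h1 := hf'.inner_le x hx y hy
      have h2 := Real.cos_lt_cos_of_nonneg_of_le_pi hZbody.thickness_nonneg
        hR.1.thickness_le_pi hth
      rw [hZbody.cos_thickness hf, hR.1.cos_thickness hf'] at h2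
      simp only [norm_coe_S2, mul_one] at h1
      linarith
    · exact main y x hf.symm hy
  · exact main x y hf hx

/-- Every open half-space meeting `R` contains the center `n + c m` belonging to a diametral
pair. -/
theorem exists_isDiam_inner_neg (hR : IsReduced R) (hΔ : thickness R < Real.pi / 2) {g : E3}
    {p : S2} (hp : p ∈ R) (hgp : inner ℝ g (p : E3) < 0) :
    ∃ m n : E3, IsDiam (supportCone R) (Real.cos (thickness R)) m n ∧
      inner ℝ g (n + Real.cos (thickness R) • m) < 0 := by
  obtain ⟨u, hu⟩ := hR.1.exists_pos
  have hD := hR.1.isWideCone hΔ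
  set c := Real.cos (thickness R) with hc
  set φ : S2 → E3 := fun z => (inner ℝ u (z : E3))⁻¹ • (z : E3) with hφ
  have hφc : ContinuousOn φ R := by
    refine ContinuousOn.smul (ContinuousOn.inv₀ (by fun_prop) fun z hz => (hu z hz).ne')
      (by fun_prop)
  -- the point of `φ R` farthest from a point `q` far away on the other side lies in the half-space
  obtain ⟨B, hB⟩ := hR.1.isCompact.exists_bound_of_continuousOn
    (f := fun z => ‖φ z - φ p‖ ^ 2) (by fun_prop)
  have hB' : ∀ z ∈ R, ‖φ z - φ p‖ ^ 2 ≤ B := fun z hz => by simpa using hB z hz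
  have hB0 : 0 ≤ B := by simpa using hB' p hp
  set η := -inner ℝ g (φ p) with hη
  have hηpos : 0 < η := by
    rw [hη, hφ]; simp only [inner_smul_right]
    nlinarith [mul_pos (inv_pos.2 (hu p hp)) (neg_pos.2 hgp)]
  set T := (B + 1) / (2 * η) with hT
  have hTη : 2 * T * η = B + 1 := by rw [hT]; field_simp
  have hTpos : 0 < T := by positivity
  set q := φ p + T • g with hq
  obtain ⟨e, he, hmax⟩ := hR.1.isCompact.exists_isMaxOn ⟨p, hp⟩
    (f := fun z => ‖φ z - q‖ ^ 2) (by fun_prop)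
  have hmax' : ∀ z ∈ R, ‖φ z - q‖ ^ 2 ≤ ‖φ e - q‖ ^ 2 := fun z hz => isMaxOn_iff.1 hmax z hz
  have hge : inner ℝ g (φ e) < 0 := by
    by_contra hcon
    push Not at hcon
    have h1 := hmax' p hp
    have h2 : ‖φ p - q‖ ^ 2 = ‖T • g‖ ^ 2 := by
      rw [hq, sub_add_cancel_left, norm_neg]
    have h3 : ‖φ e - q‖ ^ 2 = ‖φ e - φ p‖ ^ 2 - 2 * (T * (inner ℝ g (φ e) + η)) +
        ‖T • g‖ ^ 2 := by
      rw [hq, ← sub_sub, norm_sub_sq_real, inner_smul_right, real_inner_comm, inner_sub_right, hη]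
      ring
    have h4 := hB' e he
    rw [h2, h3] at h1
    nlinarith [mul_nonneg hTpos.le hcon]
  set v := φ e - q with hv
  have hexp : ∀ z ∈ R, ‖φ z - φ e‖ ^ 2 ≤ 2 * (inner ℝ v (φ e) - inner ℝ v (φ z)) := by
    intro z hz
    have h1 := hmax' z hz
    rw [show φ z - q = (φ z - φ e) + v by rw [hv]; abel, norm_add_sq_real,
      real_inner_comm, inner_sub_right] at h1
    linarith
  obtain ⟨z₀, hz₀, hz₀e⟩ := hR.1.exists_ne_mem_interior e
  have hinj : ∀ z ∈ R, z ≠ e → 0 < inner ℝ v (φ e) - inner ℝ v (φ z) := by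
    intro z hz hze
    have h1 := hexp z hz
    have h2 : φ z - φ e ≠ 0 := by
      intro h0
      have h3 : φ z = φ e := sub_eq_zero.1 h0
      have h4 : (z : E3) = (inner ℝ u (z : E3) * (inner ℝ u (e : E3))⁻¹) • (e : E3) := by
        rw [mul_smul, show (inner ℝ u (e : E3))⁻¹ • (e : E3) = φ z from h3.symm, hφ]
        simp only
        rw [smul_smul, mul_inv_cancel₀ (hu z hz).ne', one_smul]
      have h5 : 0 < inner ℝ u (z : E3) * (inner ℝ u (e : E3))⁻¹ :=
        mul_pos (hu z hz) (inv_pos.2 (hu e he))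
      have h6 := congrArg norm h4
      rw [norm_smul, norm_coe_S2, norm_coe_S2, mul_one, Real.norm_of_nonneg h5.le] at h6
      rw [← h6, one_smul] at h4
      exact hze (Subtype.ext h4)
    have h3 : 0 < ‖φ z - φ e‖ ^ 2 := pow_pos (norm_pos_iff.2 h2) 2
    linarith
  set d₀ := inner ℝ v (φ e) - inner ℝ v (φ z₀) with hd₀
  have hd₀pos : 0 < d₀ := hinj z₀ (interior_subset hz₀) hz₀e
  have hδpos : ∀ k : ℕ, 0 < d₀ / ((k : ℝ) + 2) := fun k => by positivity
  have hδlt : ∀ k : ℕ, d₀ / ((k : ℝ) + 2) < d₀ := fun k =>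
    div_lt_self hd₀pos (by linarith [(Nat.cast_nonneg k : (0 : ℝ) ≤ k)])
  have hδlim : Filter.Tendsto (fun k : ℕ => d₀ / ((k : ℝ) + 2)) Filter.atTop (nhds 0) :=
    tendsto_const_nhds.div_atTop
      (Filter.tendsto_atTop_add_const_right _ _ tendsto_natCast_atTop_atTop)
  choose x y a ρ hcap hxy haR hxa hya hρ horth hnear using fun k : ℕ =>
    hR.exists_cap_pair he hu hexp (hδpos k) hz₀ (hδlt k)
  obtain ⟨⟨X, Y⟩, σ, hσ, hlim⟩ := CompactSpace.tendsto_subseq fun k => (x k, y k)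
  have hlimX : Filter.Tendsto (fun k => x (σ k)) Filter.atTop (nhds X) :=
    (continuous_fst.tendsto _).comp hlim
  have hlimY : Filter.Tendsto (fun k => y (σ k)) Filter.atTop (nhds Y) :=
    (continuous_snd.tendsto _).comp hlim
  have hlimX' : Filter.Tendsto (fun k => (x (σ k) : E3)) Filter.atTop (nhds (X : E3)) :=
    (continuous_subtype_val.tendsto _).comp hlimX
  have hlimY' : Filter.Tendsto (fun k => (y (σ k) : E3)) Filter.atTop (nhds (Y : E3)) :=
    (continuous_subtype_val.tendsto _).comp hlimY
  have hδσ := hδlim.comp hσ.tendsto_atTop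
  have hlimA : Filter.Tendsto (fun k => φ (a (σ k))) Filter.atTop (nhds (φ e)) := by
    rw [tendsto_iff_norm_sub_tendsto_zero]
    have h1 : Filter.Tendsto (fun k => ‖φ (a (σ k)) - φ e‖ ^ 2) Filter.atTop (nhds 0) :=
      squeeze_zero (fun k => sq_nonneg _) (fun k => hnear (σ k))
        (by simpa using hδσ.const_mul 2)
    have h2 := h1.sqrt
    simpa [Real.sqrt_sq (norm_nonneg _)] using h2
  have hmem : ∀ {w : ℕ → S2} {W : S2}, Filter.Tendsto (fun k => (w (σ k) : E3)) Filter.atTop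
      (nhds (W : E3)) → (∀ k, 0 ≤ inner ℝ (w k : E3) (a k : E3)) →
      (∀ k : ℕ, ∀ z ∈ R, d₀ / ((k : ℝ) + 2) ≤ inner ℝ v (φ e) - inner ℝ v (φ z) →
        0 ≤ inner ℝ (w k : E3) (z : E3)) → (W : E3) ∈ supportCone R := by
    intro w W hW ha hz z hzR
    by_cases hze : z = e
    · have h1 : 0 ≤ inner ℝ (W : E3) (φ e) := by
        refine ge_of_tendsto' (hW.inner hlimA) fun k => ?_
        rw [hφ]; simp only [inner_smul_right]
        exact mul_nonneg (inv_nonneg.2 (hu _ (haR _)).le) (ha _)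
      rw [hφ] at h1; simp only [inner_smul_right] at h1
      rw [hze]
      exact nonneg_of_mul_nonneg_right h1 (inv_pos.2 (hu e he))
    · refine ge_of_tendsto (hW.inner tendsto_const_nhds) ?_
      have h1 := hδσ.eventually_le_const (hinj z hzR hze)
      filter_upwards [h1] with k hk
      exact hz _ z hzR hk
  have hX := hmem hlimX' hxa fun k z hz h => (hcap k z hz h).1
  have hY := hmem hlimY' hya fun k z hz h => (hcap k z hz h).2
  have hXY : inner ℝ (X : E3) (Y : E3) = -c := by
    apply le_antisymm
    · exact le_of_tendsto' (hlimX'.inner hlimY') fun k => hxy _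
    · exact hD.le_inner_unit hX hY (norm_coe_S2 X) (norm_coe_S2 Y)
  have hdiam : IsDiam (supportCone R) c X Y := ⟨hX, hY, norm_coe_S2 X, norm_coe_S2 Y, hXY⟩
  refine ⟨X, Y, hdiam, ?_⟩
  have hO : orthPart X Y = (Y : E3) + c • (X : E3) := by
    rw [orthPart, hXY, neg_smul, sub_neg_eq_add]
  have hlimO : Filter.Tendsto (fun k => orthPart (x (σ k)) (y (σ k))) Filter.atTop
      (nhds (orthPart X Y)) :=
    hlimY'.sub ((hlimX'.inner hlimY').smul hlimX')
  have hOk : ∀ k, orthPart (x k) (y k) = inner ℝ u (orthPart (x k) (y k)) • φ (a k) := by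
    intro k
    rw [horth k, hφ]
    simp only [inner_smul_right]
    rw [smul_smul, mul_assoc, mul_inv_cancel₀ (hu _ (haR k)).ne', mul_one]
  have hOlim : orthPart X Y = inner ℝ u (orthPart X Y) • φ e := by
    refine tendsto_nhds_unique hlimO ?_
    have h1 := (Filter.Tendsto.inner (𝕜 := ℝ) (tendsto_const_nhds (x := u)) hlimO).smul hlimA
    exact h1.congr fun k => (hOk _).symm
  have hs0 : 0 ≤ inner ℝ u (orthPart X Y) := by
    refine ge_of_tendsto' ((tendsto_const_nhds (x := u)).inner hlimO) fun k => ?_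
    rw [horth, inner_smul_right]
    exact mul_nonneg (hρ _) (hu _ (haR _)).le
  have hs : 0 < inner ℝ u (orthPart X Y) := by
    refine lt_of_le_of_ne hs0 fun h0 => ?_
    rw [← h0, zero_smul, hO] at hOlim
    have h1 := hdiam.inner_center_partner
    rw [hOlim, inner_zero_left] at h1
    linarith [hD.one_sub_sq_pos]
  rw [← hO, hOlim, inner_smul_right]
  exact mul_neg_of_pos_of_neg hs hge

end IsReduced

/-! ### Consecutive diametral pairs -/

theorem IsDiam.eq_of_centers_eq (hc : 1 - c ^ 2 ≠ 0) {m₁ n₁ m₂ n₂ : E3}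
    (ha : n₁ + c • m₁ = n₂ + c • m₂) (hb : m₁ + c • n₁ = m₂ + c • n₂) : m₁ = m₂ := by
  have h : ∀ m n : E3, (1 - c ^ 2) • m = (m + c • n) - c • (n + c • m) := fun m n => by module
  exact smul_right_injective E3 hc (by simp only [h m₁ n₁, h m₂ n₂, ha, hb])

theorem IsDiam.inner_center_center {m n : E3} (h : IsDiam D c m n) :
    inner ℝ (n + c • m) (n + c • m) = 1 - c ^ 2 := by
  rw [inner_add_right, inner_smul_right, h.inner_center_self, h.inner_center_partner]; ring

/-- Two centers spanning the same line coincide, as no center is opposite to another one. -/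
theorem IsWideCone.center_eq_of_inner_sq (hD : IsWideCone D c) {m₁ n₁ m₂ n₂ : E3}
    (h₁ : IsDiam D c m₁ n₁) (h₂ : IsDiam D c m₂ n₂)
    (hsq : inner ℝ (n₁ + c • m₁) (n₂ + c • m₂) ^ 2 = (1 - c ^ 2) ^ 2) :
    n₁ + c • m₁ = n₂ + c • m₂ := by
  have k := hD.one_sub_sq_pos
  have i1 := h₁.inner_center_center
  have i2 := h₂.inner_center_center
  have i3 := h₁.inner_center_partner
  have i4 := hD.inner_center_nonneg h₂ h₁.right_mem
  generalize n₁ + c • m₁ = a₁ at *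
  generalize n₂ + c • m₂ = a₂ at *
  rcases sq_eq_sq_iff_eq_or_eq_neg.1 hsq with h | h
  · have : inner ℝ (a₁ - a₂) (a₁ - a₂) = 0 := by
      rw [inner_sub_left, inner_sub_right, inner_sub_right, i1, i2, real_inner_comm a₁ a₂, h]; ring
    exact sub_eq_zero.1 (inner_self_eq_zero.1 this)
  · have : inner ℝ (a₁ + a₂) (a₁ + a₂) = 0 := by
      rw [inner_add_left, inner_add_right, inner_add_right, i1, i2, real_inner_comm a₁ a₂, h]; ring
    have h3 := congrArg (fun v => inner ℝ v n₁) (inner_self_eq_zero.1 this)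
    simp only [inner_add_left, inner_zero_left] at h3
    linarith

/-- Two different hemispheres of diametral pairs cannot support along a common edge containing both
their centers. -/
theorem IsWideCone.center_eq_of_inner_eq_zero (hD : IsWideCone D c) {m₁ n₁ m₂ n₂ : E3}
    (h₁ : IsDiam D c m₁ n₁) (h₂ : IsDiam D c m₂ n₂) (hm : m₁ ≠ m₂)
    (h12 : inner ℝ (n₁ + c • m₁) m₂ = 0) (h21 : inner ℝ (n₂ + c • m₂) m₁ = 0) :
    n₁ + c • m₁ = n₂ + c • m₂ := by
  have k := hD.one_sub_sq_pos
  set a₁ := n₁ + c • m₁ with ha₁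
  set a₂ := n₂ + c • m₂ with ha₂
  have e11 : inner ℝ a₁ m₁ = 0 := h₁.inner_center_self
  have e22 : inner ℝ a₂ m₂ = 0 := h₂.inner_center_self
  have n1 : inner ℝ a₁ a₁ = 1 - c ^ 2 := h₁.inner_center_center
  have n2 : inner ℝ a₂ a₂ = 1 - c ^ 2 := h₂.inner_center_center
  have hmm : inner ℝ m₁ m₂ ^ 2 < 1 := by
    have l1 : inner ℝ m₁ m₂ ≤ 1 := by
      simpa [h₁.norm_left, h₂.norm_left] using real_inner_le_norm m₁ m₂
    have l2 : inner ℝ m₁ m₂ ≠ 1 := fun h => hm (eq_of_inner_eq_one h₁.norm_left h₂.norm_left h)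
    have l3 := hD.le_inner_unit h₁.left_mem h₂.left_mem h₁.norm_left h₂.norm_left
    nlinarith [hD.c_lt_one, lt_of_le_of_ne l1 l2]
  -- both centers are orthogonal to `m₁` and `m₂`, hence multiples of `m₁ × m₂`
  have prod : ∀ a b : E3, inner ℝ a m₁ = 0 → inner ℝ a m₂ = 0 →
      det3 m₁ m₂ a * det3 m₁ m₂ b = (1 - inner ℝ m₁ m₂ ^ 2) * inner ℝ a b := by
    intro a b h1 h2
    rw [det3_mul_det3, h1, h2, inner_self_of_norm_one h₁.norm_left,
      inner_self_of_norm_one h₂.norm_left, real_inner_comm m₁ m₂]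
    ring
  have p11 := prod a₁ a₁ e11 h12
  have p22 := prod a₂ a₂ h21 e22
  have p12 := prod a₁ a₂ e11 h12
  rw [n1] at p11
  rw [n2] at p22
  have hsq : inner ℝ a₁ a₂ ^ 2 = (1 - c ^ 2) ^ 2 := by
    have h0 : (1 - inner ℝ m₁ m₂ ^ 2) ^ 2 ≠ 0 := by nlinarith
    apply mul_left_cancel₀ h0
    linear_combination (-(det3 m₁ m₂ a₁ * det3 m₁ m₂ a₂) - (1 - inner ℝ m₁ m₂ ^ 2) *
      inner ℝ a₁ a₂) * p12 + det3 m₁ m₂ a₂ * det3 m₁ m₂ a₂ * p11 +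
      (1 - inner ℝ m₁ m₂ ^ 2) * (1 - c ^ 2) * p22
  exact hD.center_eq_of_inner_sq h₁ h₂ hsq

/-- If both pairs of centers of two diametral pairs are joined by edges, then `m₁, m₂` and
`n₁, n₂` are at the same distance. -/
theorem IsWideCone.inner_eq_of_faces (hD : IsWideCone D c) {m₁ n₁ m₂ n₂ g f : E3}
    (h₁ : IsDiam D c m₁ n₁) (h₂ : IsDiam D c m₂ n₂) (hm : m₂ ≠ m₁) (hn : m₂ ≠ n₁)
    (hg : g ∈ D) (hf : f ∈ D) (g0 : g ≠ 0) (f0 : f ≠ 0)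
    (ga₁ : inner ℝ (n₁ + c • m₁) g = 0) (ga₂ : inner ℝ (n₂ + c • m₂) g = 0)
    (fb₁ : inner ℝ (m₁ + c • n₁) f = 0) (fb₂ : inner ℝ (m₂ + c • n₂) f = 0) :
    inner ℝ m₁ m₂ = inner ℝ n₁ n₂ := by
  have k := hD.one_sub_sq_pos
  have hn' : m₁ ≠ n₂ := by
    rintro rfl
    exact hn (hD.partner_unique h₂.symm h₁)
  have hnn : n₁ ≠ n₂ := by
    rintro rfl
    exact hm (hD.partner_unique h₂.symm h₁.symm)
  have c12 := hD.crossing h₁ h₂ hm hn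
  have c21 := hD.crossing h₂ h₁ hm.symm hn'
  have zero_of : ∀ {t : ℝ}, 0 ≤ t → ¬ 0 < t → t = 0 := fun h h' => le_antisymm (not_lt.1 h') h
  have za21 := fun h => zero_of (hD.inner_center_nonneg h₂ h₁.left_mem) h
  have za12 := fun h => zero_of (hD.inner_center_nonneg h₁ h₂.left_mem) h
  have zb21 := fun h => zero_of (hD.inner_center_nonneg h₂.symm h₁.right_mem) h
  have zb12 := fun h => zero_of (hD.inner_center_nonneg h₁.symm h₂.right_mem) h
  by_cases hA : n₁ + c • m₁ = n₂ + c • m₂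
  · -- the hemispheres `m₁` and `m₂` touch at the same point, so each of them is a face there
    exfalso
    have b21 := zb21 fun h => hD.not_both_edges h₁ h₂ c12 h₂.left_mem hf h₂.ne_zero f0
      (hA ▸ h₂.inner_center_self) h₂.inner_center_self fb₁ fb₂ (Or.inr rfl) (Or.inl h)
    have b12 := zb12 fun h => hD.not_both_edges h₂ h₁ c21 h₁.left_mem hf h₁.ne_zero f0
      (hA ▸ h₁.inner_center_self) h₁.inner_center_self fb₂ fb₁ (Or.inr rfl) (Or.inl h)
    exact hm (IsDiam.eq_of_centers_eq k.ne' hA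
      (hD.center_eq_of_inner_eq_zero h₁.symm h₂.symm hnn b12 b21)).symm
  by_cases hB : m₁ + c • n₁ = m₂ + c • n₂
  · exfalso
    have a21 := za21 fun h => hD.not_both_edges h₁ h₂ c12 hg h₂.right_mem g0 h₂.symm.ne_zero
      ga₁ ga₂ (hB ▸ h₂.symm.inner_center_self) h₂.symm.inner_center_self (Or.inl h) (Or.inr rfl)
    have a12 := za12 fun h => hD.not_both_edges h₂ h₁ c21 hg h₁.right_mem g0 h₁.symm.ne_zero
      ga₂ ga₁ (hB ▸ h₁.symm.inner_center_self) h₁.symm.inner_center_self (Or.inl h) (Or.inr rfl)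
    exact hA (hD.center_eq_of_inner_eq_zero h₁ h₂ hm.symm a12 a21)
  have ea21 : inner ℝ (n₂ + c • m₂) m₁ = inner ℝ m₁ n₂ + c * inner ℝ m₁ m₂ := by
    rw [real_inner_comm, inner_add_right, inner_smul_right]
  have ea12 : inner ℝ (n₁ + c • m₁) m₂ = inner ℝ n₁ m₂ + c * inner ℝ m₁ m₂ := by
    rw [inner_add_left, inner_smul_left]; simp
  have eb21 : inner ℝ (m₂ + c • n₂) n₁ = inner ℝ n₁ m₂ + c * inner ℝ n₁ n₂ := by
    rw [real_inner_comm, inner_add_right, inner_smul_right]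
  have eb12 : inner ℝ (m₁ + c • n₁) n₂ = inner ℝ m₁ n₂ + c * inner ℝ n₁ n₂ := by
    rw [inner_add_left, inner_smul_left]; simp
  by_cases hp : 0 < inner ℝ (n₂ + c • m₂) m₁
  · have b21 := zb21 fun h =>
      hD.not_both_edges h₁ h₂ c12 hg hf g0 f0 ga₁ ga₂ fb₁ fb₂ (Or.inl hp) (Or.inl h)
    by_cases hp' : 0 < inner ℝ (n₁ + c • m₁) m₂
    · have b12 := zb12 fun h =>
        hD.not_both_edges h₂ h₁ c21 hg hf g0 f0 ga₂ ga₁ fb₂ fb₁ (Or.inl hp') (Or.inl h)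
      exact absurd (hD.center_eq_of_inner_eq_zero h₁.symm h₂.symm hnn b12 b21) hB
    · have a12 := za12 hp'
      rw [ea12] at a12
      rw [eb21] at b21
      exact mul_left_cancel₀ hD.c_pos.ne' (by linarith)
  · have a21 := za21 hp
    by_cases hp' : 0 < inner ℝ (n₁ + c • m₁) m₂
    · have b12 := zb12 fun h =>
        hD.not_both_edges h₂ h₁ c21 hg hf g0 f0 ga₂ ga₁ fb₂ fb₁ (Or.inl hp') (Or.inl h)
      rw [ea21] at a21
      rw [eb12] at b12
      exact mul_left_cancel₀ hD.c_pos.ne' (by linarith)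
    · exact absurd (hD.center_eq_of_inner_eq_zero h₁ h₂ hm.symm (za12 hp') a21) hA

/-- A nonnegative functional vanishing at the centers `a₁`, `a₂`: the cross product of the centers,
or `m₁` if they coincide. -/
theorem IsWideCone.exists_face (hD : IsWideCone D c) {m₁ n₁ m₂ n₂ : E3} (h₁ : IsDiam D c m₁ n₁)
    (h₂ : IsDiam D c m₂ n₂)
    (h : ∀ g : E3, (∀ p, inner ℝ g p = det3 (n₁ + c • m₁) (n₂ + c • m₂) p) → g ∈ D) :
    ∃ g ∈ D, g ≠ 0 ∧ inner ℝ (n₁ + c • m₁) g = 0 ∧ inner ℝ (n₂ + c • m₂) g = 0 := by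
  have k := hD.one_sub_sq_pos
  by_cases hA : n₁ + c • m₁ = n₂ + c • m₂
  · exact ⟨m₁, h₁.left_mem, h₁.ne_zero, h₁.inner_center_self, hA ▸ h₁.inner_center_self⟩
  obtain ⟨g, hg⟩ := exists_cross (n₁ + c • m₁) (n₂ + c • m₂)
  refine ⟨g, h g hg, fun h0 => ?_, ?_, ?_⟩
  · have e := inner_cross_self hg
    rw [h0, inner_zero_left, h₁.inner_center_center, h₂.inner_center_center] at e
    exact hA (hD.center_eq_of_inner_sq h₁ h₂ (by linarith))
  · rw [real_inner_comm, hg]; simp only [det3_eq_coord]; ring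
  · rw [real_inner_comm, hg]; simp only [det3_eq_coord]; ring

theorem IsConvexBody.strictlyBetween {C : Set S2} (hC : IsConvexBody C) {x y z : S2}
    (hx : Supports C x) (hy : Supports C y) (hz : Supports C z)
    (h : PosOrd (supportCone C) x y z) : StrictlyBetween C x y z := by
  refine ⟨⟨hx, hy, hz⟩, ⟨?_, ?_, ?_⟩, ?_⟩
  iterate 3
    · rintro rfl
      rcases h with h | ⟨v, _, _, _, _, h⟩ <;>
      · simp only [det3_eq_coord, PiLp.sub_apply] at h
        linarith
  · refine h.imp id ?_
    rintro ⟨v, hv, h1, h2, h3, h⟩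
    have hv0 : v ≠ 0 := by
      rintro rfl
      simp [det3_eq_coord] at h
    have hpos : 0 < ‖v‖⁻¹ := inv_pos.2 (norm_pos_iff.2 hv0)
    have hperp : ∀ w : S2, inner ℝ v (w : E3) = 0 → direction v hv0 ∈ greatCircle w := by
      intro w hw
      change inner ℝ (w : E3) (‖v‖⁻¹ • v) = 0
      rw [inner_smul_right, real_inner_comm, hw, mul_zero]
    refine ⟨direction v hv0, hC.mem_of_forall_supportCone fun d hd => ?_,
      ⟨hperp x h1, hperp y h2, hperp z h3⟩, ?_⟩
    · change 0 ≤ inner ℝ (‖v‖⁻¹ • v) d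
      rw [inner_smul_left]
      exact mul_nonneg hpos.le (hv d hd)
    · change 0 < det3 (‖v‖⁻¹ • v) _ _
      rw [← det3_rotate, det3_smul_right, det3_rotate]
      exact mul_pos hpos h

namespace IsReduced

variable {R : Set S2}

/-- If no diametral pair lies between two diametral pairs, then both functionals given by the
centers of these pairs are nonnegative on `R`. -/
theorem det3_centers_nonneg (hR : IsReduced R) (hΔ : thickness R < Real.pi / 2) {c : ℝ}
    (hc : c = Real.cos (thickness R)) {m₁ n₁ m₂ n₂ : E3}
    (h₁ : IsDiam (supportCone R) c m₁ n₁) (h₂ : IsDiam (supportCone R) c m₂ n₂)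
    (hno : ∀ m n, IsDiam (supportCone R) c m n → ¬ PosOrd (supportCone R) m₁ m m₂) (p : S2)
    (hp : p ∈ R) :
    0 ≤ det3 (n₁ + c • m₁) (n₂ + c • m₂) p ∧ 0 ≤ det3 (m₁ + c • n₁) (m₂ + c • n₂) p := by
  have hD := hR.1.isWideCone hΔ
  rw [← hc] at hD
  have dup : ∀ u v : E3, det3 u v u = 0 ∧ det3 u v v = 0 ∧ det3 u u v = 0 := fun u v => by
    simp only [det3_eq_coord]
    exact ⟨by ring, by ring, by ring⟩
  constructor
  · by_contra hneg
    push Not at hneg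
    obtain ⟨g, hg⟩ := exists_cross (n₁ + c • m₁) (n₂ + c • m₂)
    rw [← hg] at hneg
    obtain ⟨m, n, h, hlt⟩ := hR.exists_isDiam_inner_neg hΔ hp hneg
    rw [← hc, hg] at hlt
    rw [← hc] at h
    have e12 : m₁ ≠ m₂ := by
      rintro rfl
      rw [hD.partner_unique h₁ h₂, (dup _ _).2.2] at hlt
      exact lt_irrefl _ hlt
    have e13 : m₁ ≠ m := by
      rintro rfl
      rw [hD.partner_unique h₁ h, (dup _ _).1] at hlt
      exact lt_irrefl _ hlt
    have e23 : m₂ ≠ m := by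
      rintro rfl
      rw [hD.partner_unique h₂ h, (dup _ _).2.1] at hlt
      exact lt_irrefl _ hlt
    rcases hD.ordPairs_or h₁ h₂ h e12 e13 e23 with ho | ho
    · exact absurd ho.2.1 (not_le.2 hlt)
    · exact hno m n h ho.1
  · by_contra hneg
    push Not at hneg
    obtain ⟨g, hg⟩ := exists_cross (m₁ + c • n₁) (m₂ + c • n₂)
    rw [← hg] at hneg
    obtain ⟨n, m, h, hlt⟩ := hR.exists_isDiam_inner_neg hΔ hp hneg
    rw [← hc, hg] at hlt
    rw [← hc] at h
    have e12 : m₁ ≠ m₂ := by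
      rintro rfl
      rw [hD.partner_unique h₁ h₂, (dup _ _).2.2] at hlt
      exact lt_irrefl _ hlt
    have e13 : m₁ ≠ m := by
      rintro rfl
      rw [hD.partner_unique h₁ h.symm, (dup _ _).1] at hlt
      exact lt_irrefl _ hlt
    have e23 : m₂ ≠ m := by
      rintro rfl
      rw [hD.partner_unique h₂ h.symm, (dup _ _).2.1] at hlt
      exact lt_irrefl _ hlt
    rcases hD.ordPairs_or h₁ h₂ h.symm e12 e13 e23 with ho | ho
    · exact absurd ho.2.2 (not_le.2 hlt)
    · exact hno m n h.symm ho.1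

/-- The two members of one diametral pair are never consecutive: on either side of it there is
a member of another diametral pair. -/
theorem exists_posOrd_of_isDiam (hR : IsReduced R) (hΔ : thickness R < Real.pi / 2) {c : ℝ}
    (hc : c = Real.cos (thickness R)) {m n : E3} (h : IsDiam (supportCone R) c m n) :
    ∃ x y, IsDiam (supportCone R) c x y ∧ PosOrd (supportCone R) m x n := by
  by_contra! hno
  have hD := hR.1.isWideCone hΔ
  rw [← hc] at hD
  have k := hD.one_sub_sq_pos
  have hdet := hR.det3_centers_nonneg hΔ hc h h.symm hno
  have hle : ∀ p : E3, det3 (n + c • m) (m + c • n) p = -((1 - c ^ 2) * det3 m n p) := by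
    intro p
    simp only [det3_eq_coord, PiLp.add_apply, PiLp.smul_apply, smul_eq_mul]; ring
  obtain ⟨g, hg⟩ := exists_cross m n
  have hneg : ∀ p ∈ R, inner ℝ g (p : E3) ≤ 0 := by
    intro p hp
    have := (hdet p hp).1
    rw [hle] at this
    rw [hg]
    nlinarith
  have g0 : g ≠ 0 := by
    rintro rfl
    have e := inner_cross_self hg
    rw [inner_zero_left, inner_self_of_norm_one h.norm_left, inner_self_of_norm_one h.norm_right,
      h.inner_eq] at e
    linarith
  obtain ⟨p, hp⟩ := hR.1.2.2
  have hgm : -g ∈ supportCone R := fun q hq => by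
    rw [inner_neg_left]; linarith [hneg q hq]
  have hpos := IsConvexBody.inner_pos_of_mem_interior hp hgm (neg_ne_zero.2 g0)
  rw [inner_neg_right, real_inner_comm, neg_pos] at hpos
  obtain ⟨x, y, hxy, hlt⟩ := hR.exists_isDiam_inner_neg hΔ (interior_subset hp) hpos
  rw [← hc] at hxy hlt
  have expand : inner ℝ g (y + c • x) = det3 m n y + c * det3 m n x := by
    rw [hg, det3_add_right, det3_smul_right]
  rw [expand] at hlt
  have dup : det3 m n m = 0 ∧ det3 m n n = 0 := by
    simp only [det3_eq_coord]
    exact ⟨by ring, by ring⟩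
  have ord : ∀ z : E3, det3 m n z < 0 → PosOrd (supportCone R) m z n := fun z hz =>
    Or.inl (by rw [det3_swap]; linarith)
  by_cases hx : det3 m n x < 0
  · exact hno x y hxy (ord x hx)
  · by_cases hy : det3 m n y < 0
    · exact hno y x hxy.symm (ord y hy)
    · nlinarith [hD.c_pos]

end IsReduced

/-! ### The arcs between consecutive centers -/

theorem smul_semicircleCenter {D : Set E3} {c : ℝ} {m n : S2} (h : IsDiam D c (m : E3) (n : E3))
    (hl : IsLunePair m n) :
    √(1 - c ^ 2) • (semicircleCenter m n : E3) = (n : E3) + c • (m : E3) := by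
  have h1 := norm_orthPart_sq m n
  rw [h.inner_eq, neg_sq] at h1
  rw [← h1, Real.sqrt_sq (norm_nonneg _), norm_smul_semicircleCenter hl, orthPart, h.inner_eq,
    neg_smul, sub_neg_eq_add]

theorem IsConvexBody.arc_subset_frontier {C : Set S2} (hC : IsConvexBody C) {a b : S2}
    (ha : a ∈ C) (hb : b ∈ C) {g : E3} (hg : g ∈ supportCone C) (g0 : g ≠ 0)
    (hga : inner ℝ (a : E3) g = 0) (hgb : inner ℝ (b : E3) g = 0) : arc a b ⊆ frontier C := by
  intro p hp
  refine hC.mem_frontier (hC.2.1.2 a ha b hb hp) hg g0 ?_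
  obtain ⟨s, t, -, -, h⟩ := hp
  rw [h, inner_add_right, inner_smul_right, inner_smul_right, real_inner_comm, hga,
    real_inner_comm, hgb]
  ring

end SphGeom

open SphGeom in
theorem theorem1 (R : Set S2) (hR : SphGeom.IsReduced R)
    (hΔ : SphGeom.thickness R < Real.pi / 2)
    (m₁ m₂ : S2) (hm₁ : SphGeom.Supports R m₁) (hm₂ : SphGeom.Supports R m₂)
    (hw₁ : SphGeom.width R m₁ = SphGeom.thickness R)
    (hw₂ : SphGeom.width R m₂ = SphGeom.thickness R)
    (hbetween : ∀ m : S2, SphGeom.StrictlyBetween R m₁ m m₂ →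
      SphGeom.thickness R < SphGeom.width R m)
    (n₁ n₂ : S2) (hn₁ : SphGeom.IsStar R m₁ n₁) (hn₂ : SphGeom.IsStar R m₂ n₂)
    (a₁ a₂ b₁ b₂ : S2)
    (ha₁ : a₁ = SphGeom.semicircleCenter m₁ n₁) (ha₂ : a₂ = SphGeom.semicircleCenter m₂ n₂)
    (hb₁ : b₁ = SphGeom.semicircleCenter n₁ m₁) (hb₂ : b₂ = SphGeom.semicircleCenter n₂ m₂) :
    SphGeom.arc a₁ a₂ ⊆ frontier R ∧ SphGeom.arc b₁ b₂ ⊆ frontier R ∧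
      SphGeom.sphDist a₁ a₂ = SphGeom.sphDist b₁ b₂ := by
  have hC := hR.1
  have hD := hC.isWideCone hΔ
  obtain ⟨c, hc⟩ : ∃ c, c = Real.cos (thickness R) := ⟨_, rfl⟩
  have h₁ := IsConvexBody.isDiam_of_isStar hm₁ hw₁ hn₁
  have h₂ := IsConvexBody.isDiam_of_isStar hm₂ hw₂ hn₂
  have f₁ := hC.isFarthest_of_isDiam hΔ h₁
  have f₂ := hC.isFarthest_of_isDiam hΔ h₂
  rw [← hc] at hD h₁ h₂
  have hno : ∀ m n, IsDiam (supportCone R) c m n →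
      ¬ PosOrd (supportCone R) (m₁ : E3) m (m₂ : E3) := by
    intro m n h hord
    have h' : IsDiam (supportCone R) (Real.cos (thickness R))
        ((⟨m, by simpa using h.norm_left⟩ : S2) : E3) ((⟨n, by simpa using h.norm_right⟩ : S2) : E3) :=
      hc ▸ h
    have hs := hC.supports_left (hC.isFarthest_of_isDiam hΔ h')
    exact absurd (hbetween _ (hC.strictlyBetween hm₁ hs hm₂ hord))
      (not_lt.2 (IsConvexBody.width_le_thickness hC hΔ h'))
  have hdet := hR.det3_centers_nonneg hΔ hc h₁ h₂ hno
  obtain ⟨g, hg, g0, ga₁, ga₂⟩ := hD.exists_face h₁ h₂ fun g hg p hp => by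
    rw [hg]; exact (hdet p hp).1
  obtain ⟨f, hf, f0, fb₁, fb₂⟩ := hD.exists_face h₁.symm h₂.symm fun g hg p hp => by
    rw [hg]; exact (hdet p hp).2
  have s0 : 0 < √(1 - c ^ 2) := Real.sqrt_pos.2 hD.one_sub_sq_pos
  have ea₁ := smul_semicircleCenter h₁ hn₁.2.1
  have ea₂ := smul_semicircleCenter h₂ hn₂.2.1
  have eb₁ := smul_semicircleCenter h₁.symm hn₁.2.1.symm
  have eb₂ := smul_semicircleCenter h₂.symm hn₂.2.1.symm
  rw [← ha₁] at ea₁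
  rw [← ha₂] at ea₂
  rw [← hb₁] at eb₁
  rw [← hb₂] at eb₂
  have perp : ∀ {a : S2} {v w : E3}, √(1 - c ^ 2) • (a : E3) = v → inner ℝ v w = 0 →
      inner ℝ (a : E3) w = 0 := by
    rintro a _ w rfl h
    rw [inner_smul_left] at h
    exact (mul_eq_zero.1 h).resolve_left s0.ne'
  refine ⟨?_, ?_, ?_⟩
  · exact hC.arc_subset_frontier (ha₁ ▸ hC.semicircleCenter_mem f₁)
      (ha₂ ▸ hC.semicircleCenter_mem f₂) hg g0 (perp ea₁ ga₁) (perp ea₂ ga₂)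
  · exact hC.arc_subset_frontier (hb₁ ▸ hC.semicircleCenter_mem f₁.symm)
      (hb₂ ▸ hC.semicircleCenter_mem f₂.symm) hf f0 (perp eb₁ fb₁) (perp eb₂ fb₂)
  · have key : inner ℝ (m₁ : E3) (m₂ : E3) = inner ℝ (n₁ : E3) (n₂ : E3) := by
      by_cases hm : (m₂ : E3) = m₁
      · rw [hm] at h₂
        rw [hm, hD.partner_unique h₂ h₁, inner_self_S2, inner_self_S2]
      · refine hD.inner_eq_of_faces h₁ h₂ hm (fun hn => ?_) hg hf g0 f0 ga₁ ga₂ fb₁ fb₂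
        obtain ⟨x, y, hxy, hord⟩ := hR.exists_posOrd_of_isDiam hΔ hc h₁
        exact hno x y hxy (hn ▸ hord)
    have hinner : inner ℝ (a₁ : E3) (a₂ : E3) = inner ℝ (b₁ : E3) (b₂ : E3) := by
      have h : (√(1 - c ^ 2) * √(1 - c ^ 2)) * inner ℝ (a₁ : E3) (a₂ : E3) =
          (√(1 - c ^ 2) * √(1 - c ^ 2)) * inner ℝ (b₁ : E3) (b₂ : E3) := by
        have e1 : inner ℝ (√(1 - c ^ 2) • (a₁ : E3)) (√(1 - c ^ 2) • (a₂ : E3)) =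
            inner ℝ (√(1 - c ^ 2) • (b₁ : E3)) (√(1 - c ^ 2) • (b₂ : E3)) := by
          rw [ea₁, ea₂, eb₁, eb₂]
          simp only [inner_add_left, inner_add_right, inner_smul_left, inner_smul_right,
            conj_trivial, key]
          ring
        simp only [inner_smul_left, inner_smul_right, conj_trivial] at e1
        linarith
      exact mul_left_cancel₀ (mul_pos s0 s0).ne' h
    simp only [sphDist, InnerProductGeometry.angle, norm_coe_S2, hinner]
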